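/- \textbf{The calculus $\mathbf{L}\Diamond$.} Let $\mathrm{Pr}=\{p_1,p_2,\dots\}$ be a countably infinite set of primitive types. For a set $\mathcal B\subseteq\mathrm{Pr}$, let $\operatorname{Tp}(\mathcal B)$ be the smallest set containing $\mathcal B$ and closed under forming $A\backslash B$, $B/A$, $A\bullet B$, $\Diamond A$, $\Box^{\downarrow}A$; a type is an element of $\operatorname{Tp}(\mathrm{Pr})$. The length is given by $\|p\|=1$ for primitive $p$, $\|A\backslash B\|=\|B/A\|=\|A\bullet B\|=\|A\|+\|B\|$, and $\|\Diamond A\|=\|\Box^{\downarrow}A\|=\|A\|+2$. A type tree is either a type or $\langle\Gamma\rangle$ with $\Gamma$ a type hedge, and a type hedge is a finite (possibly empty) sequence of type trees; the yield of a hedge is the string of types obtained by removing all angle brackets. A sequent $\Gamma\Rightarrow A$ consists of a hedge $\Gamma$ and a type $A$. A context $\Gamma[\blacksquare]$ is a hedge with exactly one leaf labeled $\blacksquare$, and $\Gamma[\Delta]$ is the result of replacing that leaf by the hedge $\Delta$. A sequent is provable in $\mathbf{L}\Diamond$, written $\vdash_{\mathbf{L}\Diamond}\Gamma\Rightarrow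 A$, if it can be derived from the initial sequents $p_i\Rightarrow p_i$ by the following rules (premises before the colon, conclusion after it): \begin{itemize} \item $\Gamma\Rightarrow A$ and $\Delta[B]\Rightarrow C$ : $\Delta[\Gamma\;A\backslash B]\Rightarrow C$; \quad $A\;\Pi\Rightarrow B$ : $\Pi\Rightarrow A\backslash B$ (with $\Pi$ nonempty); \item $\Gamma\Rightarrow A$ and $\Delta[B]\Rightarrow C$ : $\Delta[B/A\;\Gamma]\Rightarrow C$; \quad $\Pi\;A\Rightarrow B$ : $\Pi\Rightarrow B/A$ (with $\Pi$ nonempty); \item $\Gamma[A\;B]\Rightarrow C$ : $\Gamma[A\bullet B]\Rightarrow C$; \quad $\Gamma\Rightarrow A$ and $\Delta\Rightarrow B$ : $\Gamma\;\Delta\Rightarrow A\bullet B$; \item $\Gamma[\langle A\rangle]\Rightarrow B$ : $\Gamma[\Diamond A]\Rightarrow B$; \quad $\Gamma\Rightarrow A$ : $\langle\Gamma\rangle\Rightarrow\Diamond A$; \item $\Gamma[A]\Rightarrow B$ : $\Gamma[\langle\Box^{\downarrow}A\rangle]\Rightarrow B$; \quad $\langle\Gamma\rangle\Rightarrow A$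 : $\Gamma\Rightarrow\Box^{\downarrow}A$; \item (Cut) $\Gamma\Rightarrow A$ and $\Delta[A]\Rightarrow B$ : $\Delta[\Gamma]\Rightarrow B$. \end{itemize} For a set $\mathcal S$ of sequents, $\mathcal S\vdash_{\mathrm{Cut}}\Gamma\Rightarrow A$ means that $\Gamma\Rightarrow A$ can be derived from elements of $\mathcal S$ using Cut only. \textbf{Lemma.} Let $\mathcal B$ be a finite set of primitive types and $m$ a natural number. Let $\mathcal T_{\mathcal B,m}$ be the set consisting of \begin{itemize} \item all sequents $A_1\dots A_k\Rightarrow A_{k+1}$ with $k\le 2$, $A_i\in\operatorname{Tp}(\mathcal B)$ and $\|A_i\|\le m$ for $1\le i\le k+1$, and $\vdash_{\mathbf{L}\Diamond}A_1\dots A_k\Rightarrow A_{k+1}$; \item all sequents $\langle A\rangle\Rightarrow\Diamond A$ and all sequents $\langle\Box^{\downarrow}A\rangle\Rightarrow A$ with $A\in\operatorname{Tp}(\mathcal B)$ and $\|A\|\le m-2$. \end{itemize} Then $\mathcal T_{\mathcal B,m}$ is finite, and for every sequent $\Gamma\Rightarrow A_{n+1}$ such that the yield of $\Gamma$ is $A_1\dots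 A_n$ $(n\ge 0)$ with $A_i\in\operatorname{Tp}(\mathcal B)$ and $\|A_i\|\le m$ for $i=1,\dots,n+1$, \[ \vdash_{\mathbf{L}\Diamond}\Gamma\Rightarrow A_{n+1}\quad\text{if and only if}\quad \mathcal T_{\mathcal B,m}\vdash_{\mathrm{Cut}}\Gamma\Rightarrow A_{n+1}. \] -/

import Mathlib

namespace LDiamond

/-- Types; the primitive types form a countably infinite supply indexed by `ℕ`. -/
inductive Ty : Type
  | prim (i : ℕ) : Ty
  /-- `under A B` is `A \ B`. -/
  | under (A B : Ty) : Ty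
  /-- `over B A` is `B / A`. -/
  | over (B A : Ty) : Ty
  /-- `prod A B` is `A • B`. -/
  | prod (A B : Ty) : Ty
  /-- `dia A` is `◇A`. -/
  | dia (A : Ty) : Ty
  /-- `box A` is `□↓A`. -/
  | box (A : Ty) : Ty

/-- The length `‖A‖` of a type. -/
def Ty.length : Ty → ℕ
  | .prim _ => 1
  | .under A B => A.length + B.length
  | .over B A => B.length + A.length
  | .prod A B => A.length + B.length
  | .dia A => A.length + 2
  | .box A => A.length + 2

/-- `InTp P A` says that `A ∈ Tp(P)`, where `P` is a set of primitive types. -/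
inductive InTp (P : Set ℕ) : Ty → Prop
  | prim {i : ℕ} : i ∈ P → InTp P (.prim i)
  | under {A B : Ty} : InTp P A → InTp P B → InTp P (.under A B)
  | over {A B : Ty} : InTp P B → InTp P A → InTp P (.over B A)
  | prod {A B : Ty} : InTp P A → InTp P B → InTp P (.prod A B)
  | dia {A : Ty} : InTp P A → InTp P (.dia A)
  | box {A : Ty} : InTp P A → InTp P (.box A)

/-- Type trees: `leaf A` is a single node labeled `A`, and `node Γ` is `⟨Γ⟩`. -/
inductive Tree : Type
  | leaf (A : Ty) : Tree
  | node (Γ : List Tree) : Tree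

/-- Type hedges: finite, possibly empty, sequences of type trees. -/
abbrev Hedge : Type := List Tree

mutual

/-- The string of leaf labels of a tree. -/
def Tree.yield : Tree → List Ty
  | .leaf A => [A]
  | .node Γ => hedgeYield Γ

/-- The yield of a hedge. -/
def hedgeYield : List Tree → List Ty
  | [] => []
  | T :: Γ => T.yield ++ hedgeYield Γ

end

/-- Contexts: hedges with exactly one leaf labeled by the hole `■`. -/
inductive Ctx : Type
  /-- `L ■ R` -/
  | hole (L R : Hedge) : Ctx
  /-- `L ⟨Γ[■]⟩ R` -/
  | node (L : Hedge) (Γ : Ctx) (R : Hedge) : Ctx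

/-- `Γ.fill Δ` is `Γ[Δ]`. -/
def Ctx.fill : Ctx → Hedge → Hedge
  | .hole L R, Δ => L ++ Δ ++ R
  | .node L Γ R, Δ => L ++ [Tree.node (Γ.fill Δ)] ++ R

/-- Sequents. -/
structure Sequent : Type where
  antecedent : Hedge
  succedent : Ty

infix:50 " ⇒ " => Sequent.mk

open _root_.LDiamond.Tree in
/-- Provability in `L◇`. -/
inductive Provable : Sequent → Prop
  | init (i : ℕ) : Provable ([leaf (.prim i)] ⇒ .prim i)
  | underL {Δ : Ctx} {Γ : Hedge} {A B C : Ty} :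
      Provable (Γ ⇒ A) → Provable (Δ.fill [leaf B] ⇒ C) →
      Provable (Δ.fill (Γ ++ [leaf (.under A B)]) ⇒ C)
  | underR {Γ : Hedge} {A B : Ty} : Γ ≠ [] →
      Provable (leaf A :: Γ ⇒ B) → Provable (Γ ⇒ .under A B)
  | overL {Δ : Ctx} {Γ : Hedge} {A B C : Ty} :
      Provable (Γ ⇒ A) → Provable (Δ.fill [leaf B] ⇒ C) →
      Provable (Δ.fill (leaf (.over B A) :: Γ) ⇒ C)
  | overR {Γ : Hedge} {A B : Ty} : Γ ≠ [] →
      Provable (Γ ++ [leaf A] ⇒ B) → Provable (Γ ⇒ .over B A)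
  | prodL {Γ : Ctx} {A B C : Ty} :
      Provable (Γ.fill [leaf A, leaf B] ⇒ C) → Provable (Γ.fill [leaf (.prod A B)] ⇒ C)
  | prodR {Γ Δ : Hedge} {A B : Ty} :
      Provable (Γ ⇒ A) → Provable (Δ ⇒ B) → Provable (Γ ++ Δ ⇒ .prod A B)
  | diaL {Γ : Ctx} {A B : Ty} :
      Provable (Γ.fill [node [leaf A]] ⇒ B) → Provable (Γ.fill [leaf (.dia A)] ⇒ B)
  | diaR {Γ : Hedge} {A : Ty} :
      Provable (Γ ⇒ A) → Provable ([node Γ] ⇒ .dia A)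
  | boxL {Γ : Ctx} {A B : Ty} :
      Provable (Γ.fill [leaf A] ⇒ B) → Provable (Γ.fill [node [leaf (.box A)]] ⇒ B)
  | boxR {Γ : Hedge} {A : Ty} :
      Provable ([node Γ] ⇒ A) → Provable (Γ ⇒ .box A)
  | cut {Δ : Ctx} {Γ : Hedge} {A B : Ty} :
      Provable (Γ ⇒ A) → Provable (Δ.fill [leaf A] ⇒ B) → Provable (Δ.fill Γ ⇒ B)

/-- `CutDerivable S s` is `S ⊢_Cut s`: `s` is derivable from elements of `S` by Cut only. -/
inductive CutDerivable (S : Set Sequent) : Sequent → Prop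
  | mem {s : Sequent} : s ∈ S → CutDerivable S s
  | cut {Δ : Ctx} {Γ : Hedge} {A B : Ty} :
      CutDerivable S (Γ ⇒ A) → CutDerivable S (Δ.fill [Tree.leaf A] ⇒ B) →
      CutDerivable S (Δ.fill Γ ⇒ B)

/-- The set `S_{P,m}` of provable bracket-free sequents with at most two antecedent types,
all of whose types are in `Tp(P)` and have length at most `m`. -/
def shortSequents (P : Set ℕ) (m : ℕ) : Set Sequent :=
  {s | ∃ (As : List Ty) (C : Ty), s = (As.map Tree.leaf ⇒ C) ∧ As.length ≤ 2 ∧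
    (∀ A ∈ As, InTp P A ∧ A.length ≤ m) ∧ InTp P C ∧ C.length ≤ m ∧ Provable s}

/-- The set `T_{P,m}`; the condition `‖A‖ ≤ m - 2` is written as `‖A‖ + 2 ≤ m`. -/
def cutBase (P : Set ℕ) (m : ℕ) : Set Sequent :=
  shortSequents P m ∪
  {s | ∃ A : Ty, InTp P A ∧ A.length + 2 ≤ m ∧ s = ([Tree.node [Tree.leaf A]] ⇒ .dia A)} ∪
  {s | ∃ A : Ty, InTp P A ∧ A.length + 2 ≤ m ∧ s = ([Tree.node [Tree.leaf (.box A)]] ⇒ A)}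

end LDiamond

-- The argument follows Pentus: a provable sequent is decomposed into short ones by measuring
-- interpolants in a free group. That Cut derivations from the base are sound is immediate; the
-- content is the other direction.
--
-- Cut is first eliminated by a semantic argument (`RulesClosed.of_provable`). In a cut-free
-- derivation each initial sequent can receive its own tag, and each matching of a bracket with a
-- modality its own index. The result is a decorated sequent in which every letter occurs at most
-- twice (`Lift.rulesClosed`). Hedges are written as strings there, so that brackets are items on a
-- par with leaves.
--
-- Every nonempty well-bracketed segment of a derivable string has an interpolant in which no letter
-- occurs more often than inside the segment or than outside of it (`DP.hasInterp`). In a thin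
-- sequent each letter therefore occurs at most once in the interpolant, so the word interpreting it
-- is reduced. As derivable sequents are equations in the free group (`DP.valL_eq`), the length of
-- the interpolant is the norm of the value of the segment (`ThinDP.interpolate`). Segments of small
-- value thus have short interpolants.
--
-- The values of the items of the antecedent, followed by the inverse of the succedent, multiply to
-- 1. Since the Cayley graph of a free group is a tree, some two neighbours have a product no longer
-- than the longer of them (`exists_norm_mul_le`). Two neighbouring leaves can then be replaced by a
-- short interpolant, and a last leaf next to the succedent is treated similarly. If a bracket is
-- next to a leaf or to the succedent, its generator must cancel, so that type contains the index of
-- the bracket. Thinness leaves no further occurrence of the index. Solving the equation for that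
-- type, without any cancellation, shows that the interpolants of the surrounding pieces, even with
-- one modality added, have length at most `m`; the bracket is then absorbed through a base sequent
-- for `◇` or `□↓`. Two brackets are never such neighbours. Induction on the length of the string
-- concludes (`ThinDP.cutProv`).

namespace LDiamond

-- Well-bracketed strings

/-- The items of a hedge written as a string: leaves, opening and closing brackets. -/
inductive Tok (T ι : Type) : Type
  | leaf (A : T) : Tok T ι
  | op (i : ι) : Tok T ι
  | cl (i : ι) : Tok T ι

/-- `Runs X s t`: reading the string `X` takes the stack `s` of open brackets to `t`. -/
def Runs {T ι : Type} : List (Tok T ι) → List ι → List ι → Prop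
  | [], s, t => s = t
  | .leaf _ :: X, s, t => Runs X s t
  | .op i :: X, s, t => Runs X (i :: s) t
  | .cl i :: X, s, t => ∃ s', s = i :: s' ∧ Runs X s' t

/-- Well-bracketed strings. -/
def Bal {T ι : Type} (X : List (Tok T ι)) : Prop := Runs X [] []

section Runs

variable {T ι : Type} {X Y Z L R : List (Tok T ι)} {s t u : List ι} {i j : ι}

theorem runs_append : Runs (X ++ Y) s t ↔ ∃ u, Runs X s u ∧ Runs Y u t := by
  induction X generalizing s with
  | nil => simp [Runs]
  | cons a X ih =>
    cases a with
    | leaf A => simpa [Runs] using ih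
    | op i => simpa [Runs] using ih
    | cl i =>
      simp only [List.cons_append, Runs, ih]
      constructor
      · rintro ⟨s', rfl, u, h1, h2⟩
        exact ⟨u, ⟨s', rfl, h1⟩, h2⟩
      · rintro ⟨u, ⟨s', rfl, h1⟩, h2⟩
        exact ⟨s', rfl, u, h1, h2⟩

theorem Runs.frame (h : Runs X s t) (u : List ι) : Runs X (s ++ u) (t ++ u) := by
  induction X generalizing s with
  | nil => simpa [Runs] using h
  | cons a X ih =>
    cases a with
    | leaf A => exact ih h
    | op i => exact ih (s := i :: s) h
    | cl i =>
      obtain ⟨s', rfl, h⟩ := h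
      exact ⟨s' ++ u, rfl, ih h⟩

theorem Runs.det (h : Runs X s t) (h' : Runs X s u) : t = u := by
  induction X generalizing s with
  | nil => exact h.symm.trans h'
  | cons a X ih =>
    cases a with
    | leaf A => exact ih h h'
    | op i => exact ih (s := i :: s) h h'
    | cl i =>
      obtain ⟨s', rfl, h⟩ := h
      obtain ⟨s'', e, h'⟩ := h'
      cases e
      exact ih h h'

theorem Bal.runs (h : Bal X) (s : List ι) : Runs X s s := h.frame s

@[simp] theorem bal_nil : Bal ([] : List (Tok T ι)) := rfl

@[simp] theorem bal_leaf_cons {A : T} : Bal (.leaf A :: X) ↔ Bal X := Iff.rfl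

theorem Bal.append (hX : Bal X) (hY : Bal Y) : Bal (X ++ Y) :=
  runs_append.2 ⟨_, hX, hY⟩

/-- `X` leaves a stack `s`, and `Y` read from the empty stack leaves some `t`. Reading `Y` on top of
`s` then gives `t ++ s`, which must be empty. This is what makes the pieces well-bracketed when a
segment straddles the boundary of a premise. -/
theorem Bal.overlap (h : Bal (X ++ Y)) (h' : Bal (Y ++ Z)) : Bal X ∧ Bal Y ∧ Bal Z := by
  obtain ⟨s, h1, h2⟩ := runs_append.1 h
  obtain ⟨t, h3, h4⟩ := runs_append.1 h'
  have := h2.det (by simpa using h3.frame s)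
  obtain ⟨rfl, rfl⟩ := List.append_eq_nil_iff.1 this.symm
  exact ⟨h1, h3, h4⟩

theorem Bal.right (hX : Bal X) (h : Bal (X ++ Y)) : Bal Y :=
  (Bal.overlap (X := []) (Y := X) (by simpa) h).2.2

theorem Bal.left (hY : Bal Y) (h : Bal (X ++ Y)) : Bal X :=
  (Bal.overlap (Z := []) h (by simpa)).1

theorem Bal.replace (hX : Bal X) (hY : Bal Y) (h : Bal (L ++ (X ++ R))) :
    Bal (L ++ (Y ++ R)) := by
  obtain ⟨s, h1, h2⟩ := runs_append.1 h
  obtain ⟨t, h3, h4⟩ := runs_append.1 h2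
  have := h3.det (hX.runs s)
  subst this
  exact runs_append.2 ⟨_, h1, runs_append.2 ⟨_, hY.runs _, h4⟩⟩

theorem Bal.wrap (h : Bal X) (i : ι) : Bal (.op i :: (X ++ [.cl i])) :=
  runs_append.2 ⟨[i], h.runs [i], [], rfl, rfl⟩

theorem Bal.unwrap (hX : Bal X) (h : Bal (.op i :: (X ++ .cl j :: R))) : i = j ∧ Bal R := by
  obtain ⟨s, h1, s', e, h2⟩ := runs_append.1 h
  have := h1.det (hX.runs [i])
  subst this
  cases e
  exact ⟨rfl, h2⟩

/-- A well-bracketed string has no well-bracketed extension by an unmatched closing bracket. -/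
theorem Bal.not_cl (h : Bal (X ++ Y)) : ¬ Bal (Y ++ .cl i :: Z) := by
  intro h'
  obtain ⟨s, h1, h2⟩ := runs_append.1 h
  obtain ⟨t, h3, s', e, h4⟩ := runs_append.1 h'
  have := h2.det (by simpa using h3.frame s)
  subst e
  simp at this

theorem Bal.not_op (h : Bal (X ++ Y)) : ¬ Bal (.op i :: X) := by
  intro h'
  obtain ⟨s, h1, h2⟩ := runs_append.1 h
  have := Runs.det (X := X) (by simpa using h1.frame [i]) h'
  simp at this

theorem Runs.exists_cl (h : Runs X (t ++ i :: s) []) :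
    ∃ Y R, X = Y ++ .cl i :: R ∧ Runs Y t [] := by
  induction X generalizing t with
  | nil => simp [Runs] at h
  | cons a X ih =>
    cases a with
    | leaf A =>
      obtain ⟨Y, R, rfl, h1⟩ := ih h
      exact ⟨.leaf A :: Y, R, rfl, h1⟩
    | op j =>
      obtain ⟨Y, R, rfl, h1⟩ := ih (t := j :: t) h
      exact ⟨.op j :: Y, R, rfl, h1⟩
    | cl j =>
      obtain ⟨s', e, h⟩ := h
      cases t with
      | nil =>
        cases e
        exact ⟨[], X, rfl, rfl⟩
      | cons k t =>
        cases e
        obtain ⟨Y, R, rfl, h1⟩ := ih h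
        exact ⟨.cl j :: Y, R, rfl, t, rfl, h1⟩

theorem Runs.exists_op (h : Runs X [] (t ++ i :: s)) :
    ∃ L Y, X = L ++ .op i :: Y ∧ Runs Y [] t := by
  induction X using List.reverseRecOn generalizing t with
  | nil => simp [Runs] at h
  | append_singleton X a ih =>
    obtain ⟨u, h1, h2⟩ := runs_append.1 h
    cases a with
    | leaf A =>
      cases h2
      obtain ⟨L, Y, rfl, h3⟩ := ih h1
      exact ⟨L, Y ++ [.leaf A], by simp, runs_append.2 ⟨_, h3, by simp [Runs]⟩⟩
    | op j =>
      have h2 : j :: u = t ++ i :: s := h2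
      cases t with
      | nil =>
        cases h2
        exact ⟨X, [], rfl, rfl⟩
      | cons k t =>
        cases h2
        obtain ⟨L, Y, rfl, h3⟩ := ih h1
        exact ⟨L, Y ++ [.op j], by simp, runs_append.2 ⟨_, h3, by simp [Runs]⟩⟩
    | cl j =>
      obtain ⟨s', rfl, h2⟩ := h2
      cases h2
      obtain ⟨L, Y, rfl, h3⟩ := ih (t := j :: t) h1
      exact ⟨L, Y ++ [.cl j], by simp, runs_append.2 ⟨_, h3, by simp [Runs]⟩⟩

theorem Bal.exists_cl (h : Bal (L ++ .op i :: R)) :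
    ∃ Y R', R = Y ++ .cl i :: R' ∧ Bal Y := by
  obtain ⟨s, -, h⟩ := runs_append.1 h
  exact Runs.exists_cl (t := []) h

theorem Bal.exists_op (h : Bal (L ++ .cl i :: R)) :
    ∃ L' Y, L = L' ++ .op i :: Y ∧ Bal Y := by
  obtain ⟨s, h, s', rfl, -⟩ := runs_append.1 h
  exact Runs.exists_op (t := []) h

end Runs

-- Decorated types and their cut-free calculus

/-- Types whose primitive types carry tags and whose modalities carry indices. -/
inductive DTy : Type
  | prim (p k : ℕ) : DTy
  | ldiv (A B : DTy) : DTy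
  | rdiv (B A : DTy) : DTy
  | prod (A B : DTy) : DTy
  | dia (i : ℕ) (A : DTy) : DTy
  | box (i : ℕ) (A : DTy) : DTy

/-- Strings of decorated types and indexed brackets. -/
abbrev Str : Type := List (Tok DTy ℕ)

/-- The calculus without Cut for decorated types, with hedges written as strings. -/
inductive DP : Str → DTy → Prop
  | init (p k : ℕ) : DP [.leaf (.prim p k)] (.prim p k)
  | underL {L Γ R : Str} {A B C : DTy} : DP Γ A → DP (L ++ .leaf B :: R) C →
      DP (L ++ (Γ ++ .leaf (.ldiv A B) :: R)) C
  | underR {Γ : Str} {A B : DTy} : Γ ≠ [] → DP (.leaf A :: Γ) B → DP Γ (.ldiv A B)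
  | overL {L Γ R : Str} {A B C : DTy} : DP Γ A → DP (L ++ .leaf B :: R) C →
      DP (L ++ .leaf (.rdiv B A) :: (Γ ++ R)) C
  | overR {Γ : Str} {A B : DTy} : Γ ≠ [] → DP (Γ ++ [.leaf A]) B → DP Γ (.rdiv B A)
  | prodL {L R : Str} {A B C : DTy} : DP (L ++ .leaf A :: .leaf B :: R) C →
      DP (L ++ .leaf (.prod A B) :: R) C
  | prodR {Γ Δ : Str} {A B : DTy} : DP Γ A → DP Δ B → DP (Γ ++ Δ) (.prod A B)
  | diaL {L R : Str} {i : ℕ} {A C : DTy} : DP (L ++ .op i :: .leaf A :: .cl i :: R) C →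
      DP (L ++ .leaf (.dia i A) :: R) C
  | diaR {Γ : Str} {i : ℕ} {A : DTy} : DP Γ A → DP (.op i :: (Γ ++ [.cl i])) (.dia i A)
  | boxL {L R : Str} {i : ℕ} {A C : DTy} : DP (L ++ .leaf A :: R) C →
      DP (L ++ .op i :: .leaf (.box i A) :: .cl i :: R) C
  -- On strings, `Bal Γ` is needed to say that the two displayed brackets match each other;
  -- otherwise `Γ` could close the first and open the last.
  | boxR {Γ : Str} {i : ℕ} {A : DTy} : Bal Γ → Γ ≠ [] → DP (.op i :: (Γ ++ [.cl i])) A →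
      DP Γ (.box i A)

theorem DP.bal {Γ : Str} {C : DTy} (h : DP Γ C) : Bal Γ := by
  induction h with
  | init p k => rfl
  | @underL L Γ R A B C _ _ h1 h2 =>
    have := Bal.replace (X := [.leaf B]) (Y := Γ ++ [.leaf (.ldiv A B)]) (L := L) (R := R) rfl
      (h1.append (by simp)) h2
    simpa using this
  | underR _ _ h => exact h
  | @overL L Γ R A B C _ _ h1 h2 =>
    exact Bal.replace (X := [.leaf B]) (Y := .leaf (.rdiv B A) :: Γ) (L := L) (R := R) rfl
      h1 h2
  | overR _ _ h => exact Bal.left (by simp) h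
  | @prodL L R A B C _ h =>
    exact Bal.replace (X := [.leaf A, .leaf B]) (Y := [.leaf (.prod A B)]) rfl rfl h
  | prodR _ _ h1 h2 => exact h1.append h2
  | @diaL L R i A C _ h =>
    exact Bal.replace (X := [.op i, .leaf A, .cl i]) (Y := [.leaf (.dia i A)])
      (Bal.wrap (X := [.leaf A]) rfl i) rfl h
  | diaR _ h => exact h.wrap _
  | @boxL L R i A C _ h =>
    exact Bal.replace (X := [.leaf A]) (Y := [.op i, .leaf (.box i A), .cl i]) rfl
      (Bal.wrap (X := [.leaf (.box i A)]) rfl i) h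
  | boxR h _ _ _ => exact h

theorem DP.ne_nil {Γ : Str} {C : DTy} (h : DP Γ C) : Γ ≠ [] := by
  induction h <;> simp_all

/-- Atoms of the free group in which sequents are interpreted. -/
inductive Letter : Type
  | pr (p k : ℕ) : Letter
  | op (i : ℕ) : Letter
  | cl (i : ℕ) : Letter
  deriving DecidableEq

/-- `1` if the letters agree and `0` otherwise. -/
def Letter.ind (x y : Letter) : ℕ := if x = y then 1 else 0

/-- The number of occurrences of a letter in a type. -/
def DTy.cnt (x : Letter) : DTy → ℕ
  | .prim p k => x.ind (.pr p k)
  | .ldiv A B => A.cnt x + B.cnt x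
  | .rdiv B A => B.cnt x + A.cnt x
  | .prod A B => A.cnt x + B.cnt x
  | .dia i A => x.ind (.op i) + A.cnt x + x.ind (.cl i)
  | .box i A => x.ind (.op i) + A.cnt x + x.ind (.cl i)

def Tok.cnt (x : Letter) : Tok DTy ℕ → ℕ
  | .leaf A => A.cnt x
  | .op i => x.ind (.op i)
  | .cl i => x.ind (.cl i)

/-- The number of occurrences of a letter in a string. -/
def cntL (x : Letter) : Str → ℕ
  | [] => 0
  | a :: X => a.cnt x + cntL x X

@[simp] theorem cntL_nil (x : Letter) : cntL x [] = 0 := rfl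

@[simp] theorem cntL_cons (x : Letter) (a : Tok DTy ℕ) (X : Str) :
    cntL x (a :: X) = a.cnt x + cntL x X := rfl

@[simp] theorem cntL_append (x : Letter) (X Y : Str) :
    cntL x (X ++ Y) = cntL x X + cntL x Y := by
  induction X with
  | nil => simp
  | cons a X ih => simp [ih, Nat.add_assoc]

end LDiamond

-- Interpolation

namespace LDiamond

/-- The boundary between `X` and `Y` falls after, within or before the segment `D`; every case
analysis on the position of a segment rests on this. -/
theorem append_eq_append₃ {α : Type} {X Y L D R : List α} (h : X ++ Y = L ++ (D ++ R)) :
    (∃ Z, X = L ++ (D ++ Z) ∧ R = Z ++ Y) ∨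
    (∃ D₁ D₂, D = D₁ ++ D₂ ∧ X = L ++ D₁ ∧ Y = D₂ ++ R) ∨
    (∃ Z, L = X ++ Z ∧ Y = Z ++ (D ++ R)) := by
  rcases List.append_eq_append_iff.1 h with ⟨Z, h1, h2⟩ | ⟨Z, h1, h2⟩
  · exact .inr (.inr ⟨Z, h1, h2⟩)
  · rcases List.append_eq_append_iff.1 h2 with ⟨W, h3, h4⟩ | ⟨W, h3, h4⟩
    · exact .inl ⟨W, by rw [h1, h3], h4⟩
    · exact .inr (.inl ⟨Z, W, h3, h1, h4⟩)

theorem append_cons_eq_append₃ {α : Type} {X Y L D R : List α} {a : α}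
    (h : X ++ a :: Y = L ++ (D ++ R)) :
    (∃ Z, X = L ++ (D ++ Z) ∧ R = Z ++ a :: Y) ∨
    (∃ D₁ D₂, D = D₁ ++ a :: D₂ ∧ X = L ++ D₁ ∧ Y = D₂ ++ R) ∨
    (∃ Z, L = X ++ a :: Z ∧ Y = Z ++ (D ++ R)) := by
  rcases append_eq_append₃ h with h | ⟨D₁, D₂, h1, h2, h3⟩ | ⟨Z, h1, h2⟩
  · exact .inl h
  · cases D₂ with
    | nil => exact .inl ⟨[], by simp [h1, h2], h3.symm⟩
    | cons b D₂ =>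
      cases h3
      exact .inr (.inl ⟨D₁, D₂, h1, h2, rfl⟩)
  · cases Z with
    | nil =>
      cases D with
      | nil => exact .inl ⟨[], by simpa using h1.symm, by simpa using h2.symm⟩
      | cons b D =>
        cases h2
        exact .inr (.inl ⟨[], D, rfl, by simpa using h1.symm, rfl⟩)
    | cons b Z =>
      cases h2
      exact .inr (.inr ⟨Z, h1, rfl⟩)

/-- The segment `D` of the derivable sequent `L D R ⇒ C` has an interpolant in which no letter
occurs more often than in `D` or than outside of `D`. -/
def Interp (L D R : Str) (C : DTy) : Prop :=
  ∃ E, DP D E ∧ DP (L ++ .leaf E :: R) C ∧ (∀ x, E.cnt x ≤ cntL x D) ∧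
    ∀ x, E.cnt x ≤ cntL x L + cntL x R + C.cnt x

/-- All well-bracketed nonempty segments of `Γ` have interpolants. -/
def HasInterp (Γ : Str) (C : DTy) : Prop :=
  ∀ L D R : Str, Γ = L ++ (D ++ R) → Bal D → D ≠ [] → Interp L D R C

theorem HasInterp.init (p k : ℕ) : HasInterp [.leaf (.prim p k)] (.prim p k) := by
  intro L D R h hb hn
  rcases append_cons_eq_append₃ (X := []) h with ⟨Z, h1, -⟩ | ⟨D₁, D₂, rfl, h1, h2⟩ | ⟨Z, -, h2⟩
  · simp_all
  · obtain ⟨rfl, rfl⟩ := List.append_eq_nil_iff.1 h1.symm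
    obtain ⟨rfl, rfl⟩ := List.append_eq_nil_iff.1 h2.symm
    exact ⟨_, .init p k, .init p k, fun x => by simp [Tok.cnt], fun x => by simp⟩
  · simp_all

/-- If the segment lies inside `Γ`, avoids the principal part or contains all of it, one premise
supplies the interpolant. If it straddles an end of the principal part, the interpolants of both
premises are combined by a product or a division. -/
theorem HasInterp.underL {L₀ Γ R₀ : Str} {A B C : DTy} (d1 : DP Γ A)
    (d2 : DP (L₀ ++ .leaf B :: R₀) C) (ih1 : HasInterp Γ A)
    (ih2 : HasInterp (L₀ ++ .leaf B :: R₀) C) :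
    HasInterp (L₀ ++ (Γ ++ .leaf (.ldiv A B) :: R₀)) C := by
  intro L D R h hb hn
  rw [← List.append_assoc] at h
  have inside : ∀ X Y, Γ = X ++ (D ++ Y) → L = L₀ ++ X → R = Y ++ .leaf (.ldiv A B) :: R₀ →
      Interp L D R C := by
    rintro X Y rfl rfl rfl
    obtain ⟨E, h1, h2, h3, h4⟩ := ih1 X D Y rfl hb hn
    refine ⟨E, h1, by simpa using DP.underL h2 d2, h3, fun x => ?_⟩
    have := h4 x
    simp [Tok.cnt, DTy.cnt]; omega
  have before : ∀ Z, L₀ = L ++ (D ++ Z) → R = Z ++ (Γ ++ .leaf (.ldiv A B) :: R₀) →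
      Interp L D R C := by
    rintro Z rfl rfl
    obtain ⟨E, h1, h2, h3, h4⟩ := ih2 L D (Z ++ .leaf B :: R₀) (by simp) hb hn
    refine ⟨E, h1, ?_, h3, fun x => ?_⟩
    · simpa using DP.underL (L := L ++ .leaf E :: Z) d1 (by simpa using h2)
    · have := h4 x
      simp [Tok.cnt, DTy.cnt] at this ⊢; omega
  have around : ∀ L₂ R₁, L₀ = L ++ L₂ → D = L₂ ++ (Γ ++ .leaf (.ldiv A B) :: R₁) →
      R₀ = R₁ ++ R → Interp L D R C := by
    rintro L₂ R₁ rfl rfl rfl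
    obtain ⟨E, h1, h2, h3, h4⟩ := ih2 L (L₂ ++ .leaf B :: R₁) R (by simp)
      (Bal.replace (X := Γ ++ [.leaf (.ldiv A B)]) (Y := [.leaf B]) (d1.bal.append (by simp))
        (by simp) (by simpa using hb)) (by simp)
    refine ⟨E, DP.underL d1 h1, h2, fun x => ?_, h4⟩
    have := h3 x
    simp [Tok.cnt, DTy.cnt] at this ⊢; omega
  rcases append_cons_eq_append₃ h with ⟨Y, h1, rfl⟩ | ⟨D₁, D₂, rfl, h1, rfl⟩ | ⟨Z, rfl, rfl⟩
  · rcases append_eq_append₃ h1 with ⟨Z, rfl, rfl⟩ | ⟨L₂, Γ₁, rfl, rfl, rfl⟩ | ⟨Z, rfl, rfl⟩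
    · exact before Z rfl (by simp)
    · by_cases e1 : L₂ = []
      · subst e1
        exact inside [] Y (by simp) (by simp) rfl
      by_cases e2 : Γ₁ = []
      · subst e2
        exact before [] (by simp) (by simp)
      obtain ⟨b1, b2, b3⟩ := Bal.overlap hb d1.bal
      obtain ⟨E, h1, h2, h3, h4⟩ := ih1 [] Γ₁ Y rfl b2 e2
      obtain ⟨F, g1, g2, g3, g4⟩ := ih2 L L₂ (.leaf B :: R₀) (by simp) b1 e1
      refine ⟨.prod F E, .prodR g1 h1, .prodL ?_, fun x => ?_, fun x => ?_⟩
      · have := DP.underL (L := L ++ [.leaf F]) h2 (by simpa using g2)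
        simpa only [List.append_assoc, List.cons_append, List.nil_append] using this
      · have := h3 x
        have := g3 x
        simp [DTy.cnt]; omega
      · have := h4 x
        have := g4 x
        simp [Tok.cnt, DTy.cnt] at *; omega
    · exact inside Z Y rfl rfl rfl
  · rcases List.append_eq_append_iff.1 h1 with ⟨Γ₁, rfl, rfl⟩ | ⟨L₂, rfl, rfl⟩
    · by_cases e1 : Γ₁ = []
      · subst e1
        exact around [] D₂ (by simp) (by simp) rfl
      obtain ⟨b1, b2, b3⟩ := Bal.overlap d1.bal hb
      obtain ⟨E, h1, h2, h3, h4⟩ := ih1 [] Γ₁ D₁ rfl b1 e1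
      obtain ⟨F, g1, g2, g3, g4⟩ := ih2 L₀ (.leaf B :: D₂) R (by simp) b3 (by simp)
      -- `E` interpolates `Γ₁`, the part of `Γ` left outside of `D`. Hence its two bounds change
      -- roles: what bounds it from outside of `Γ₁` lies in `D`, and conversely.
      refine ⟨.ldiv E F, .underR (by simp) ?_, ?_, fun x => ?_, fun x => ?_⟩
      · simpa using DP.underL (L := []) h2 g1
      · simpa using DP.underL h1 g2
      · have := h4 x
        have := g3 x
        simp [Tok.cnt, DTy.cnt] at *; omega
      · have := h3 x
        have := g4 x
        simp [DTy.cnt] at *; omega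
    · exact around L₂ D₂ rfl (by simp) rfl
  · obtain ⟨E, h1, h2, h3, h4⟩ := ih2 (L₀ ++ .leaf B :: Z) D R (by simp) hb hn
    refine ⟨E, h1, ?_, h3, fun x => ?_⟩
    · simpa using DP.underL (R := Z ++ .leaf E :: R) d1 (by simpa using h2)
    · have := h4 x
      simp [Tok.cnt, DTy.cnt] at this ⊢; omega

theorem HasInterp.overL {L₀ Γ R₀ : Str} {A B C : DTy} (d1 : DP Γ A)
    (d2 : DP (L₀ ++ .leaf B :: R₀) C) (ih1 : HasInterp Γ A)
    (ih2 : HasInterp (L₀ ++ .leaf B :: R₀) C) :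
    HasInterp (L₀ ++ .leaf (.rdiv B A) :: (Γ ++ R₀)) C := by
  intro L D R h hb hn
  have inside : ∀ X Y, Γ = X ++ (D ++ Y) → L = L₀ ++ .leaf (.rdiv B A) :: X → R = Y ++ R₀ →
      Interp L D R C := by
    rintro X Y rfl rfl rfl
    obtain ⟨E, h1, h2, h3, h4⟩ := ih1 X D Y rfl hb hn
    refine ⟨E, h1, by simpa using DP.overL h2 d2, h3, fun x => ?_⟩
    have := h4 x
    simp [Tok.cnt, DTy.cnt]; omega
  have after : ∀ Z, L = L₀ ++ .leaf (.rdiv B A) :: (Γ ++ Z) → R₀ = Z ++ (D ++ R) →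
      Interp L D R C := by
    rintro Z rfl rfl
    obtain ⟨E, h1, h2, h3, h4⟩ := ih2 (L₀ ++ .leaf B :: Z) D R (by simp) hb hn
    refine ⟨E, h1, ?_, h3, fun x => ?_⟩
    · simpa using DP.overL (R := Z ++ .leaf E :: R) d1 (by simpa using h2)
    · have := h4 x
      simp [Tok.cnt, DTy.cnt] at this ⊢; omega
  have around : ∀ L₂ R₁, L₀ = L ++ L₂ → D = L₂ ++ .leaf (.rdiv B A) :: (Γ ++ R₁) →
      R₀ = R₁ ++ R → Interp L D R C := by
    rintro L₂ R₁ rfl rfl rfl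
    obtain ⟨E, h1, h2, h3, h4⟩ := ih2 L (L₂ ++ .leaf B :: R₁) R (by simp)
      (Bal.replace (X := .leaf (.rdiv B A) :: Γ) (Y := [.leaf B]) d1.bal
        (by simp) (by simpa using hb)) (by simp)
    refine ⟨E, DP.overL d1 h1, h2, fun x => ?_, h4⟩
    have := h3 x
    simp [Tok.cnt, DTy.cnt] at this ⊢; omega
  rcases append_cons_eq_append₃ h with ⟨Z, rfl, rfl⟩ | ⟨D₁, D₂, rfl, rfl, h1⟩ | ⟨Z, rfl, h1⟩
  · obtain ⟨E, h1, h2, h3, h4⟩ := ih2 L D (Z ++ .leaf B :: R₀) (by simp) hb hn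
    refine ⟨E, h1, ?_, h3, fun x => ?_⟩
    · simpa using DP.overL (L := L ++ .leaf E :: Z) d1 (by simpa using h2)
    · have := h4 x
      simp [Tok.cnt, DTy.cnt] at this ⊢; omega
  · rcases List.append_eq_append_iff.1 h1 with ⟨R₁, rfl, rfl⟩ | ⟨Γ₂, rfl, rfl⟩
    · exact around D₁ R₁ rfl rfl rfl
    · by_cases e1 : Γ₂ = []
      · subst e1
        exact around D₁ [] rfl (by simp) (by simp)
      obtain ⟨b1, b2, b3⟩ := Bal.overlap (X := D₁ ++ [.leaf (.rdiv B A)]) (by simpa using hb) d1.bal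
      obtain ⟨E, h1, h2, h3, h4⟩ := ih1 D₂ Γ₂ [] (by simp) b3 e1
      obtain ⟨F, g1, g2, g3, g4⟩ := ih2 L (D₁ ++ [.leaf B]) R₀ (by simp)
        ((Bal.left (by simp) b1).append (by simp)) (by simp)
      refine ⟨.rdiv F E, .overR (by simp) ?_, ?_, fun x => ?_, fun x => ?_⟩
      · simpa using DP.overL (R := []) h2 g1
      · simpa using DP.overL h1 g2
      · have := h4 x
        have := g3 x
        simp [Tok.cnt, DTy.cnt] at *; omega
      · have := h3 x
        have := g4 x
        simp [DTy.cnt] at *; omega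
  · rcases append_eq_append₃ h1 with ⟨Y, rfl, rfl⟩ | ⟨Γ₂, R₁, rfl, rfl, rfl⟩ | ⟨Y, rfl, rfl⟩
    · exact inside Z Y rfl rfl rfl
    · by_cases e1 : R₁ = []
      · subst e1
        exact inside Z [] (by simp) (by simp) (by simp)
      by_cases e2 : Γ₂ = []
      · subst e2
        exact after [] (by simp) (by simp)
      obtain ⟨b1, b2, b3⟩ := Bal.overlap d1.bal hb
      obtain ⟨E, h1, h2, h3, h4⟩ := ih1 Z Γ₂ [] (by simp) b2 e2
      obtain ⟨F, g1, g2, g3, g4⟩ := ih2 (L₀ ++ [.leaf B]) R₁ R (by simp) b3 e1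
      refine ⟨.prod E F, .prodR h1 g1, .prodL ?_, fun x => ?_, fun x => ?_⟩
      · simpa using DP.overL (R := .leaf F :: R) h2 (by simpa using g2)
      · have := h3 x
        have := g3 x
        simp [DTy.cnt]; omega
      · have := h4 x
        have := g4 x
        simp [Tok.cnt, DTy.cnt] at *; omega
    · exact after Y rfl rfl

theorem HasInterp.underR {Γ : Str} {A B : DTy} (ih : HasInterp (.leaf A :: Γ) B) :
    HasInterp Γ (.ldiv A B) := by
  rintro L D R rfl hb hn
  obtain ⟨E, h1, h2, h3, h4⟩ := ih (.leaf A :: L) D R rfl hb hn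
  refine ⟨E, h1, .underR (by simp) h2, h3, fun x => ?_⟩
  have := h4 x
  simp [Tok.cnt, DTy.cnt] at this ⊢; omega

theorem HasInterp.overR {Γ : Str} {A B : DTy} (ih : HasInterp (Γ ++ [.leaf A]) B) :
    HasInterp Γ (.rdiv B A) := by
  rintro L D R rfl hb hn
  obtain ⟨E, h1, h2, h3, h4⟩ := ih L D (R ++ [.leaf A]) (by simp) hb hn
  refine ⟨E, h1, .overR (by simp) (by simpa using h2), h3, fun x => ?_⟩
  have := h4 x
  simp [Tok.cnt, DTy.cnt] at this ⊢; omega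

/-- Interpolation is preserved when a segment is fused into a single leaf. -/
theorem HasInterp.fuse {L₀ X R₀ : Str} {A C : DTy} (hX : Bal X) (hX' : X ≠ [])
    (hc : ∀ x, A.cnt x = cntL x X)
    (rule : ∀ {L R : Str} {C : DTy}, DP (L ++ (X ++ R)) C → DP (L ++ .leaf A :: R) C)
    (ih : HasInterp (L₀ ++ (X ++ R₀)) C) : HasInterp (L₀ ++ .leaf A :: R₀) C := by
  intro L D R h hb hn
  rcases append_cons_eq_append₃ h with ⟨Z, rfl, rfl⟩ | ⟨D₁, D₂, rfl, rfl, rfl⟩ | ⟨Z, rfl, rfl⟩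
  · obtain ⟨E, h1, h2, h3, h4⟩ := ih L D (Z ++ (X ++ R₀)) (by simp) hb hn
    refine ⟨E, h1, ?_, h3, fun x => ?_⟩
    · simpa using rule (L := L ++ .leaf E :: Z) (by simpa using h2)
    · have := h4 x
      simp [Tok.cnt, hc] at this ⊢; omega
  · obtain ⟨E, h1, h2, h3, h4⟩ := ih L (D₁ ++ (X ++ D₂)) R (by simp)
      (Bal.replace (X := [.leaf A]) (by simp) hX hb) (by simp [hX'])
    refine ⟨E, rule h1, h2, fun x => ?_, h4⟩
    have := h3 x
    simp [Tok.cnt, hc] at this ⊢; omega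
  · obtain ⟨E, h1, h2, h3, h4⟩ := ih (L₀ ++ (X ++ Z)) D R (by simp) hb hn
    refine ⟨E, h1, ?_, h3, fun x => ?_⟩
    · simpa using rule (R := Z ++ .leaf E :: R) (by simpa using h2)
    · have := h4 x
      simp [Tok.cnt, hc] at this ⊢; omega

theorem HasInterp.prodR {Γ Δ : Str} {A B : DTy} (d1 : DP Γ A) (d2 : DP Δ B)
    (ih1 : HasInterp Γ A) (ih2 : HasInterp Δ B) : HasInterp (Γ ++ Δ) (.prod A B) := by
  intro L D R h hb hn
  have left : ∀ Z, Γ = L ++ (D ++ Z) → R = Z ++ Δ → Interp L D R (.prod A B) := by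
    rintro Z rfl rfl
    obtain ⟨E, h1, h2, h3, h4⟩ := ih1 L D Z rfl hb hn
    refine ⟨E, h1, by simpa using DP.prodR h2 d2, h3, fun x => ?_⟩
    have := h4 x
    simp [DTy.cnt]; omega
  have right : ∀ Z, L = Γ ++ Z → Δ = Z ++ (D ++ R) → Interp L D R (.prod A B) := by
    rintro Z rfl rfl
    obtain ⟨E, h1, h2, h3, h4⟩ := ih2 Z D R rfl hb hn
    refine ⟨E, h1, by simpa using DP.prodR d1 h2, h3, fun x => ?_⟩
    have := h4 x
    simp [DTy.cnt]; omega
  rcases append_eq_append₃ h with ⟨Z, h1, h2⟩ | ⟨D₁, D₂, rfl, rfl, rfl⟩ | ⟨Z, h1, h2⟩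
  · exact left Z h1 h2
  · by_cases e1 : D₁ = []
    · subst e1
      exact right [] (by simp) (by simp)
    by_cases e2 : D₂ = []
    · subst e2
      exact left [] (by simp) (by simp)
    obtain ⟨-, b1, b2⟩ := Bal.overlap d1.bal hb
    obtain ⟨E, h1, h2, h3, h4⟩ := ih1 L D₁ [] (by simp) b1 e1
    obtain ⟨F, g1, g2, g3, g4⟩ := ih2 [] D₂ R rfl b2 e2
    refine ⟨.prod E F, .prodR h1 g1, .prodL (by simpa using DP.prodR h2 g2), fun x => ?_,
      fun x => ?_⟩
    · have := h3 x
      have := g3 x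
      simp [DTy.cnt]; omega
    · have := h4 x
      have := g4 x
      simp [DTy.cnt] at *; omega
  · exact right Z h1 h2

/-- A well-bracketed segment cannot contain just one of the two outer brackets. So it lies inside
`Γ` or is everything, and in the latter case the interpolant is `◇E`. -/
theorem HasInterp.diaR {Γ : Str} {i : ℕ} {A : DTy} (d : DP Γ A) (ih : HasInterp Γ A) :
    HasInterp (.op i :: (Γ ++ [.cl i])) (.dia i A) := by
  intro L D R h hb hn
  cases L with
  | nil =>
    rcases R.eq_nil_or_concat with rfl | ⟨R, b, rfl⟩
    · obtain ⟨E, h1, h2, h3, h4⟩ := ih [] Γ [] (by simp) d.bal d.ne_nil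
      have e : D = .op i :: (Γ ++ [.cl i]) := by simpa using h.symm
      subst e
      refine ⟨.dia i E, .diaR h1, .diaL (L := []) (.diaR h2), fun x => ?_, fun x => ?_⟩
      · have := h3 x
        simp [Tok.cnt, DTy.cnt]; omega
      · have := h4 x
        simp [DTy.cnt] at *; omega
    · cases D with
      | nil => exact absurd rfl hn
      | cons a D =>
        cases (List.cons.inj h).1
        replace h : Γ ++ [.cl i] = D ++ R.concat b := (List.cons.inj h).2
        simp only [← List.append_assoc, List.concat_eq_append] at h
        obtain ⟨rfl, -⟩ := List.append_inj' h rfl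
        exact absurd hb (Bal.not_op d.bal)
  | cons a L =>
    cases (List.cons.inj h).1
    replace h : Γ ++ [.cl i] = L ++ (D ++ R) := (List.cons.inj h).2
    rcases R.eq_nil_or_concat with rfl | ⟨R, b, rfl⟩
    · rcases D.eq_nil_or_concat with rfl | ⟨D, b, rfl⟩
      · exact absurd rfl hn
      · simp only [List.append_nil, ← List.append_assoc, List.concat_eq_append] at h
        obtain ⟨rfl, e⟩ := List.append_inj' h rfl
        cases e
        exact absurd (by simpa using hb) (Bal.not_cl (i := i) (Z := []) d.bal)
    · simp only [← List.append_assoc, List.concat_eq_append] at h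
      obtain ⟨rfl, e⟩ := List.append_inj' h rfl
      cases e
      obtain ⟨E, h1, h2, h3, h4⟩ := ih L D R (by simp) hb hn
      refine ⟨E, h1, by simpa using DP.diaR (i := i) h2, h3, fun x => ?_⟩
      have := h4 x
      simp [DTy.cnt, Tok.cnt]; omega

theorem HasInterp.boxR {Γ : Str} {i : ℕ} {A : DTy} (hΓ : Bal Γ)
    (ih : HasInterp (.op i :: (Γ ++ [.cl i])) A) : HasInterp Γ (.box i A) := by
  rintro L D R rfl hb hn
  obtain ⟨E, h1, h2, h3, h4⟩ := ih (.op i :: L) D (R ++ [.cl i]) (by simp) hb hn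
  refine ⟨E, h1, .boxR (Bal.replace (Y := [.leaf E]) hb (by simp) hΓ) (by simp)
    (by simpa using h2), h3, fun x => ?_⟩
  have := h4 x
  simp [DTy.cnt, Tok.cnt] at this ⊢; omega

/-- A well-bracketed segment meets the three displayed items in all of them, in none, or only in the
boxed leaf. Only the last case needs a new interpolant, namely `□↓E` with `E` an interpolant of the
leaf `A`. -/
theorem HasInterp.boxL {L₀ R₀ : Str} {i : ℕ} {A C : DTy} (ih : HasInterp (L₀ ++ .leaf A :: R₀) C) :
    HasInterp (L₀ ++ .op i :: .leaf (.box i A) :: .cl i :: R₀) C := by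
  intro L D R h hb hn
  rcases append_cons_eq_append₃ h with ⟨Z, rfl, rfl⟩ | ⟨D₁, D₂, rfl, rfl, h1⟩ | ⟨Z, rfl, h1⟩
  · obtain ⟨E, h1, h2, h3, h4⟩ := ih L D (Z ++ .leaf A :: R₀) (by simp) hb hn
    refine ⟨E, h1, ?_, h3, fun x => ?_⟩
    · simpa using DP.boxL (L := L ++ .leaf E :: Z) (i := i) (by simpa using h2)
    · have := h4 x
      simp [Tok.cnt, DTy.cnt] at this ⊢; omega
  · obtain ⟨D₃, rfl⟩ : ∃ D₃, D₂ = .leaf (.box i A) :: .cl i :: D₃ := by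
      obtain ⟨Y, R', rfl, hY⟩ := hb.exists_cl
      rcases Y with - | ⟨a, Y⟩
      · cases h1
      cases (List.cons.inj h1).1
      rcases Y with - | ⟨a, Y⟩
      · exact ⟨R', rfl⟩
      cases (List.cons.inj (List.cons.inj h1).2).1
      obtain ⟨s, e, -⟩ := hY
      cases e
    cases h1
    obtain ⟨E, h1, h2, h3, h4⟩ := ih L (D₁ ++ .leaf A :: D₃) R (by simp)
      (Bal.replace (X := [.op i, .leaf (.box i A), .cl i]) (Y := [.leaf A]) (R := D₃)
        (Bal.wrap (X := [.leaf (.box i A)]) (by simp) i) (by simp) (by exact hb)) (by simp)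
    refine ⟨E, .boxL h1, h2, fun x => ?_, h4⟩
    have := h3 x
    simp [Tok.cnt, DTy.cnt] at this ⊢; omega
  · rcases append_cons_eq_append₃ (X := []) h1 with
      ⟨Y, h2, -⟩ | ⟨D₁, D₂, rfl, h2, h3⟩ | ⟨Y, rfl, h3⟩
    · simp_all
    · obtain ⟨rfl, rfl⟩ := List.append_eq_nil_iff.1 h2.symm
      rcases D₂ with - | ⟨a, D₂⟩
      · cases h3
        obtain ⟨E, h1, h2, h3, h4⟩ := ih L₀ [.leaf A] R₀ (by simp) (by simp) (by simp)
        refine ⟨.box i E, .boxR (by simp) (by simp) (DP.boxL (L := []) h1),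
          by simpa using DP.boxL (i := i) h2, fun x => ?_, fun x => ?_⟩
        · have := h3 x
          simp [Tok.cnt, DTy.cnt] at this ⊢; omega
        · have := h4 x
          simp [Tok.cnt, DTy.cnt] at this ⊢; omega
      · obtain ⟨rfl, -⟩ := List.cons.inj h3
        obtain ⟨s, e, -⟩ := hb
        cases e
    · rcases Y with - | ⟨a, Y⟩
      · rcases D with - | ⟨a, D⟩
        · exact absurd rfl hn
        obtain ⟨rfl, -⟩ := List.cons.inj h3
        obtain ⟨s, e, -⟩ := hb
        cases e
      · cases h3
        obtain ⟨E, h1, h2, h3, h4⟩ := ih (L₀ ++ .leaf A :: Y) D R (by simp) hb hn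
        refine ⟨E, h1, ?_, h3, fun x => ?_⟩
        · simpa using DP.boxL (R := Y ++ .leaf E :: R) (i := i) (by simpa using h2)
        · have := h4 x
          simp [Tok.cnt, DTy.cnt] at this ⊢; omega

theorem DP.hasInterp {Γ : Str} {C : DTy} (h : DP Γ C) : HasInterp Γ C := by
  induction h with
  | init p k => exact .init p k
  | underL d1 d2 h1 h2 => exact .underL d1 d2 h1 h2
  | underR _ _ h => exact .underR h
  | overL d1 d2 h1 h2 => exact .overL d1 d2 h1 h2
  | overR _ _ h => exact .overR h
  | @prodL L R A B C d h =>
    exact .fuse (X := [.leaf A, .leaf B]) (by simp) (by simp) (by simp [DTy.cnt, Tok.cnt])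
      .prodL h
  | prodR d1 d2 h1 h2 => exact .prodR d1 d2 h1 h2
  | @diaL L R i A C d h =>
    exact .fuse (X := [.op i, .leaf A, .cl i]) (Bal.wrap (X := [.leaf A]) (by simp) i) (by simp)
      (by simp [DTy.cnt, Tok.cnt, Nat.add_assoc]) .diaL h
  | diaR d h => exact .diaR d h
  | boxL _ h => exact .boxL h
  | boxR hb _ _ h => exact .boxR hb h

end LDiamond

-- Norms in free groups

namespace LDiamond

section FreeGroup

open FreeGroup

variable {α : Type} [DecidableEq α]

/-- The length of the longest common prefix. -/
def lcp : List (α × Bool) → List (α × Bool) → ℕ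
  | a :: u, b :: v => if a = b then lcp u v + 1 else 0
  | _, _ => 0

/-- Words form a tree under the prefix order, and common prefixes satisfy the ultrametric
inequality. -/
theorem min_lcp_le (u v w : List (α × Bool)) : min (lcp u v) (lcp v w) ≤ lcp u w := by
  induction u generalizing v w with
  | nil => simp [lcp]
  | cons a u ih =>
    rcases v with - | ⟨b, v⟩
    · simp [lcp]
    rcases w with - | ⟨c, w⟩
    · simp [lcp]
    by_cases h1 : a = b
    · by_cases h2 : b = c
      · subst h1 h2
        have := ih v w
        simp only [lcp, if_true]
        omega
      · simp [lcp, h2]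
    · simp [lcp, h1]

theorem norm_mk_of_isReduced {u : List (α × Bool)} (h : FreeGroup.IsReduced u) :
    (mk u).norm = u.length := by
  rw [FreeGroup.norm, toWord_mk, h.reduce_eq]

theorem isReduced_invRev {u : List (α × Bool)} (h : FreeGroup.IsReduced u) :
    FreeGroup.IsReduced (invRev u) := by
  rw [isReduced_iff_reduce_eq, reduce_invRev, h.reduce_eq]

theorem norm_inv_mul_add_lcp {u v : List (α × Bool)} (hu : FreeGroup.IsReduced u)
    (hv : FreeGroup.IsReduced v) :
    FreeGroup.norm ((mk u)⁻¹ * mk v) + 2 * lcp u v = u.length + v.length := by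
  induction u generalizing v with
  | nil =>
    have : (mk ([] : List (α × Bool)))⁻¹ = 1 := by simp [← one_eq_mk]
    rw [this, one_mul, norm_mk_of_isReduced hv]
    simp [lcp]
  | cons a u ih =>
    rcases v with - | ⟨b, v⟩
    · rw [← one_eq_mk, mul_one, norm_inv_eq, norm_mk_of_isReduced hu]
      simp [lcp]
    by_cases h : a = b
    · subst h
      have e : (mk (a :: u))⁻¹ * mk (a :: v) = (mk u)⁻¹ * mk v := by
        rw [← List.singleton_append, ← mul_mk, ← List.singleton_append (l := v), ← mul_mk]
        group
      have := ih (v := v) (hu.of_cons) (hv.of_cons)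
      rw [e]
      simp only [lcp, if_true, List.length_cons]
      omega
    -- Distinct first letters leave nothing to cancel at the junction of `u⁻¹` and `v`.
    · have hr : FreeGroup.IsReduced (invRev (a :: u) ++ b :: v) := by
        refine List.isChain_append.2 ⟨isReduced_invRev hu, hv, ?_⟩
        intro x hx y hy
        rw [invRev_cons] at hx
        simp [invRev] at hx hy
        subst hx hy
        intro h1
        by_contra h2
        apply h
        ext
        · exact h1
        · revert h2
          cases a.2 <;> cases b.2 <;> simp
      rw [inv_mk, mul_mk, norm_mk_of_isReduced hr]
      simp [lcp, h, invRev_length]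

/-- The four-point condition of a tree, for the vertices `1`, `p`, `p * x`, `p * x * y` of the
Cayley graph. With `1` as base point it becomes the ultrametric inequality for common prefixes. -/
theorem norm_four_point (p x y : FreeGroup α) :
    (p * x).norm + (x * y).norm ≤ max (p.norm + y.norm) ((p * x * y).norm + x.norm) := by
  have key : ∀ g h : FreeGroup α,
      (g⁻¹ * h).norm + 2 * lcp g.toWord h.toWord = g.norm + h.norm := by
    intro g h
    have := norm_inv_mul_add_lcp (isReduced_toWord (x := g)) (isReduced_toWord (x := h))
    rwa [mk_toWord, mk_toWord] at this
  have h1 := key p (p * x)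
  have h2 := key (p * x) (p * x * y)
  have h3 := key p (p * x * y)
  have h4 := min_lcp_le p.toWord (p * x).toWord (p * x * y).toWord
  rw [show p⁻¹ * (p * x) = x by group] at h1
  rw [show (p * x)⁻¹ * (p * x * y) = y by group] at h2
  rw [show p⁻¹ * (p * x * y) = x * y by group] at h3
  omega

/-- If every two neighbours have a product longer than both, the norms of the partial products
strictly increase. In the four-point inequality the first term of the maximum is then too small, so
the second one forces the next increase. -/
theorem norm_le_norm_mul_prod (l : List (FreeGroup α)) (p x : FreeGroup α)
    (hp : FreeGroup.norm p < FreeGroup.norm (p * x))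
    (h : ∀ L a b R, x :: l = L ++ a :: b :: R → max a.norm b.norm < (a * b).norm) :
    FreeGroup.norm (p * x) ≤ FreeGroup.norm (p * x * l.prod) := by
  induction l generalizing p x with
  | nil => simp
  | cons y l ih =>
    have h1 := h [] x y l rfl
    have h2 := norm_four_point p x y
    have h3 := ih (p * x) y (by omega) fun L a b R e => h (x :: L) a b R (by simp [e])
    rw [List.prod_cons, ← mul_assoc]
    omega

/-- In a product of at least two elements of a free group that is equal to `1`, some two
consecutive factors have a product that is not longer than both of them. -/
theorem exists_norm_mul_le {l : List (FreeGroup α)} (hl : 2 ≤ l.length) (h : l.prod = 1) :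
    ∃ L a b R, l = L ++ a :: b :: R ∧ (a * b).norm ≤ max a.norm b.norm := by
  by_contra! hc
  obtain ⟨x, y, l, rfl⟩ : ∃ x y l', l = x :: y :: l' := by
    rcases l with - | ⟨x, - | ⟨y, l⟩⟩
    · simp at hl
    · simp at hl
    · exact ⟨x, y, l, rfl⟩
  have h1 := hc [] x y l rfl
  have h2 := norm_le_norm_mul_prod l x y (by omega) fun L a b R e => hc (x :: L) a b R (by simp [e])
  rw [List.prod_cons, List.prod_cons, ← mul_assoc] at h
  rw [h, FreeGroup.norm_one] at h2
  omega

/-- The generator `x` does not occur in the reduced word of `g`. -/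
def Avoids (x : α) (g : FreeGroup α) : Prop := ∀ a ∈ g.toWord, a.1 ≠ x

theorem Avoids.mul {x : α} {g h : FreeGroup α} (hg : Avoids x g) (hh : Avoids x h) :
    Avoids x (g * h) := fun a ha => by
  rcases List.mem_append.1 ((toWord_mul_sublist g h).subset ha) with h | h
  · exact hg a h
  · exact hh a h

theorem Avoids.inv {x : α} {g : FreeGroup α} (hg : Avoids x g) : Avoids x g⁻¹ := fun a ha => by
  rw [toWord_inv] at ha
  simp only [invRev, List.mem_reverse, List.mem_map] at ha
  obtain ⟨b, hb, rfl⟩ := ha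
  exact hg b hb

theorem avoids_one (x : α) : Avoids x 1 := fun a ha => by simp at ha

theorem avoids_of {x y : α} (h : y ≠ x) : Avoids x (of y) := fun a ha => by
  simp at ha
  simpa [ha] using h

theorem avoids_mk {x : α} {u : List (α × Bool)} (h : ∀ a ∈ u, a.1 ≠ x) : Avoids x (mk u) :=
  fun a ha => h a (by
    rw [toWord_mk] at ha
    exact (reduce.red (L := u)).sublist.subset ha)

/-- A generator absent from both reduced words has nothing to cancel with, so the concatenation is
already reduced. -/
theorem norm_mul_mk_mul {x : α} {g h : FreeGroup α} (hg : Avoids x g) (hh : Avoids x h) (b : Bool) :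
    FreeGroup.norm (g * mk [(x, b)] * h) = FreeGroup.norm g + 1 + FreeGroup.norm h := by
  have hr : FreeGroup.IsReduced (g.toWord ++ ((x, b) :: h.toWord)) := by
    refine List.isChain_append.2 ⟨isReduced_toWord, ?_, ?_⟩
    · refine List.isChain_cons.2 ⟨fun y hy e => ?_, isReduced_toWord⟩
      exact absurd e.symm (hh y (List.mem_of_mem_head? hy))
    · intro y hy z hz e
      simp at hz
      subst hz
      exact absurd e (hg y (List.mem_of_mem_getLast? hy))
  have := norm_mk_of_isReduced hr
  rw [← mul_mk, ← List.singleton_append, ← mul_mk, mk_toWord, mk_toWord, ← mul_assoc] at this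
  rw [this]
  simp [FreeGroup.norm]; omega

theorem norm_mul_of_mul {x : α} {g h : FreeGroup α} (hg : Avoids x g) (hh : Avoids x h) :
    (g * of x * h).norm = g.norm + 1 + h.norm := norm_mul_mk_mul hg hh true

theorem norm_mul_inv_of_mul {x : α} {g h : FreeGroup α} (hg : Avoids x g) (hh : Avoids x h) :
    (g * (of x)⁻¹ * h).norm = g.norm + 1 + h.norm := norm_mul_mk_mul hg hh false

theorem norm_of_mul_of (x y : α) : FreeGroup.norm (of x * of y) = 2 := by
  have : FreeGroup.IsReduced [(x, true), (y, true)] := by simp [FreeGroup.IsReduced]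
  exact norm_mk_of_isReduced this

end FreeGroup

-- Interpretation of decorated types in the free group

open FreeGroup

/-- The length of a decorated type. -/
def DTy.length : DTy → ℕ
  | .prim _ _ => 1
  | .ldiv A B => A.length + B.length
  | .rdiv B A => B.length + A.length
  | .prod A B => A.length + B.length
  | .dia _ A => A.length + 2
  | .box _ A => A.length + 2

theorem DTy.length_pos (A : DTy) : 0 < A.length := by
  induction A <;> simp [DTy.length] <;> omega

/-- The word that interprets a type. -/
def DTy.word : DTy → List (Letter × Bool)
  | .prim p k => [(.pr p k, true)]
  | .ldiv A B => invRev A.word ++ B.word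
  | .rdiv B A => B.word ++ invRev A.word
  | .prod A B => A.word ++ B.word
  | .dia i A => (.op i, true) :: (A.word ++ [(.cl i, true)])
  -- The inverse generators are chosen so that the brackets around `□↓A` cancel and leave the value
  -- of `A`.
  | .box i A => (.op i, false) :: (A.word ++ [(.cl i, false)])

/-- The interpretation of a type in the free group. -/
def DTy.val (A : DTy) : FreeGroup Letter := mk A.word

theorem DTy.length_word (A : DTy) : A.word.length = A.length := by
  induction A <;> simp [DTy.word, DTy.length, *]

theorem DTy.count_word (x : Letter) (A : DTy) : (A.word.map Prod.fst).count x = A.cnt x := by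
  have inv : ∀ u : List (Letter × Bool), ((invRev u).map Prod.fst).count x =
      (u.map Prod.fst).count x := by
    intro u
    simp [invRev, List.map_reverse, Function.comp_def]
  have ind : ∀ y : Letter, [y].count x = x.ind y := by
    intro y
    simp [List.count_cons, Letter.ind, eq_comm (a := y)]
  induction A with
  | prim p k => exact ind _
  | ldiv A B hA hB => simp only [word, List.map_append, List.count_append, inv, cnt, hA, hB]
  | rdiv A B hA hB => simp only [word, List.map_append, List.count_append, inv, cnt, hA, hB]
  | prod A B hA hB => simp only [word, List.map_append, List.count_append, cnt, hA, hB]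
  | dia i A hA =>
    rw [cnt, ← hA, ← ind, ← ind, word, ← List.singleton_append]
    simp only [List.map_append, List.count_append, List.map_cons, List.map_nil]
    omega
  | box i A hA =>
    rw [cnt, ← hA, ← ind, ← ind, word, ← List.singleton_append]
    simp only [List.map_append, List.count_append, List.map_cons, List.map_nil]
    omega

theorem DTy.norm_val_le (A : DTy) : FreeGroup.norm A.val ≤ A.length :=
  norm_mk_le.trans A.length_word.le

theorem DTy.avoids {x : Letter} {A : DTy} (h : A.cnt x = 0) : Avoids x A.val := by
  refine avoids_mk fun a ha e => ?_
  rw [← count_word, List.count_eq_zero] at h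
  exact h (e ▸ List.mem_map_of_mem ha)

/-- A word without repeated generators cannot contain a generator next to its inverse, hence is
reduced. -/
theorem DTy.norm_val_eq {A : DTy} (h : ∀ x, A.cnt x ≤ 1) : FreeGroup.norm A.val = A.length := by
  have hn : (A.word.map Prod.fst).Nodup :=
    List.nodup_iff_count_le_one.2 fun x => by rw [count_word]; exact h x
  rw [val, norm_mk_of_isReduced, length_word]
  refine List.Pairwise.isChain ?_
  refine (List.pairwise_map.1 hn).imp fun hab e => absurd e hab

/-- Modalities contribute both bracket letters at once, so a type linked to one bracket of a pair is
linked to the other too. -/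
theorem DTy.cnt_op_eq_cnt_cl (i : ℕ) (A : DTy) : A.cnt (.op i) = A.cnt (.cl i) := by
  induction A with
  | prim p k => simp [cnt, Letter.ind]
  | ldiv A B hA hB => simp [cnt, hA, hB]
  | rdiv A B hA hB => simp [cnt, hA, hB]
  | prod A B hA hB => simp [cnt, hA, hB]
  | dia j A hA => simp [cnt, Letter.ind, hA]; omega
  | box j A hA => simp [cnt, Letter.ind, hA]; omega

/-- The interpretation of a leaf or a bracket. -/
def Tok.val : Tok DTy ℕ → FreeGroup Letter
  | .leaf A => A.val
  | .op i => of (.op i)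
  | .cl i => of (.cl i)

/-- The interpretation of a string. -/
def valL (X : Str) : FreeGroup Letter := (X.map Tok.val).prod

@[simp] theorem valL_nil : valL [] = 1 := rfl

@[simp] theorem valL_cons (a : Tok DTy ℕ) (X : Str) : valL (a :: X) = a.val * valL X := by
  simp [valL]

@[simp] theorem valL_append (X Y : Str) : valL (X ++ Y) = valL X * valL Y := by
  simp [valL]

theorem DTy.val_ldiv (A B : DTy) : (ldiv A B).val = A.val⁻¹ * B.val := by
  simp [val, word, inv_mk]

theorem DTy.val_rdiv (A B : DTy) : (rdiv B A).val = B.val * A.val⁻¹ := by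
  simp [val, word, inv_mk]

theorem DTy.val_prod (A B : DTy) : (prod A B).val = A.val * B.val := by
  simp [val, word]

theorem DTy.val_dia (i : ℕ) (A : DTy) : (dia i A).val = of (.op i) * A.val * of (.cl i) := by
  simp [val, word, of]

theorem DTy.val_box (i : ℕ) (A : DTy) :
    (box i A).val = (of (.op i))⁻¹ * A.val * (of (.cl i))⁻¹ := by
  simp [val, word, of, inv_mk, invRev]

/-- Each rule is an identity of groups: the divisions become quotients, and the modalities multiply
by the bracket generators or by their inverses. -/
theorem DP.valL_eq {Γ : Str} {C : DTy} (h : DP Γ C) : valL Γ = C.val := by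
  induction h with
  | init p k => simp [Tok.val]
  | underL _ _ h1 h2 => simpa [Tok.val, DTy.val_ldiv, h1, mul_assoc] using h2
  | underR _ _ h => simpa [Tok.val, DTy.val_ldiv, eq_inv_mul_iff_mul_eq] using h
  | overL _ _ h1 h2 => simpa [Tok.val, DTy.val_rdiv, h1, mul_assoc] using h2
  | overR _ _ h => simpa [Tok.val, DTy.val_rdiv, eq_mul_inv_iff_mul_eq] using h
  | prodL _ h => simpa [Tok.val, DTy.val_prod, mul_assoc] using h
  | prodR _ _ h1 h2 => simp [h1, h2, DTy.val_prod]
  | diaL _ h => simpa [Tok.val, DTy.val_dia, mul_assoc] using h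
  | diaR _ h => simp [Tok.val, h, DTy.val_dia, mul_assoc]
  | boxL _ h => simpa [Tok.val, DTy.val_box, mul_assoc] using h
  | boxR _ _ _ h => rw [DTy.val_box, ← h]; simp [Tok.val, mul_assoc]

end LDiamond

-- Cut elimination by closure semantics

namespace LDiamond

mutual

/-- No bracket is empty. -/
def Tree.Good : Tree → Prop
  | .leaf _ => True
  | .node Γ => Γ ≠ [] ∧ HedgeGood Γ

/-- No bracket is empty. -/
def HedgeGood : List Tree → Prop
  | [] => True
  | T :: Γ => T.Good ∧ HedgeGood Γ

end

theorem hedgeGood_append {Γ Δ : Hedge} : HedgeGood (Γ ++ Δ) ↔ HedgeGood Γ ∧ HedgeGood Δ := by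
  induction Γ with
  | nil => simp [HedgeGood]
  | cons T Γ ih => simp [HedgeGood, ih, and_assoc]

theorem Ctx.fill_ne_nil {c : Ctx} {Δ : Hedge} (h : Δ ≠ []) : c.fill Δ ≠ [] := by
  cases c <;> simp [Ctx.fill, h]

theorem Ctx.good_of_fill {c : Ctx} {Δ : Hedge} (h : HedgeGood (c.fill Δ)) : HedgeGood Δ := by
  induction c with
  | hole L R => simp [fill, hedgeGood_append] at h; exact h.2.1
  | node L c R ih =>
    simp [fill, hedgeGood_append, HedgeGood, Tree.Good] at h
    exact ih h.2.1.2

theorem Ctx.good_fill {c : Ctx} {Δ Δ' : Hedge} (h : HedgeGood (c.fill Δ)) (h' : HedgeGood Δ')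
    (hn : Δ' ≠ []) : HedgeGood (c.fill Δ') := by
  induction c with
  | hole L R =>
    simp [fill, hedgeGood_append] at h ⊢
    exact ⟨h.1, h', h.2.2⟩
  | node L c R ih =>
    simp [fill, hedgeGood_append, HedgeGood, Tree.Good] at h ⊢
    exact ⟨h.1, ⟨fill_ne_nil hn, ih h.2.1.2⟩, h.2.2⟩

/-- No rule can create an empty bracket. Thus the right rule for `□↓`, stated without a nonemptiness
condition, in fact only applies to nonempty antecedents. -/
theorem Provable.good {s : Sequent} (h : Provable s) :
    s.antecedent ≠ [] ∧ HedgeGood s.antecedent := by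
  induction h with
  | init i => simp [HedgeGood, Tree.Good]
  | underL _ _ h1 h2 =>
    exact ⟨Ctx.fill_ne_nil (by simp), Ctx.good_fill h2.2
      (hedgeGood_append.2 ⟨h1.2, by simp [HedgeGood, Tree.Good]⟩) (by simp)⟩
  | underR hn _ h => exact ⟨hn, h.2.2⟩
  | overL _ _ h1 h2 =>
    exact ⟨Ctx.fill_ne_nil (by simp), Ctx.good_fill h2.2 ⟨trivial, h1.2⟩ (by simp)⟩
  | overR hn _ h => exact ⟨hn, (hedgeGood_append.1 h.2).1⟩
  | prodL _ h =>
    exact ⟨Ctx.fill_ne_nil (by simp), Ctx.good_fill h.2 ⟨trivial, trivial⟩ (by simp)⟩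
  | prodR _ _ h1 h2 => exact ⟨by simp [h1.1], hedgeGood_append.2 ⟨h1.2, h2.2⟩⟩
  | diaL _ h =>
    exact ⟨Ctx.fill_ne_nil (by simp), Ctx.good_fill h.2 ⟨trivial, trivial⟩ (by simp)⟩
  | diaR _ h => exact ⟨by simp, h, trivial⟩
  | boxL _ h =>
    exact ⟨Ctx.fill_ne_nil (by simp),
      Ctx.good_fill h.2 ⟨⟨by simp, trivial, trivial⟩, trivial⟩ (by simp)⟩
  | boxR _ h => exact h.2.1
  | cut _ _ h1 h2 => exact ⟨Ctx.fill_ne_nil h1.1, Ctx.good_fill h2.2 h1.2 h1.1⟩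

/-- Composition of contexts. -/
def Ctx.comp : Ctx → Ctx → Ctx
  | .hole L R, .hole L' R' => .hole (L ++ L') (R' ++ R)
  | .hole L R, .node L' c R' => .node (L ++ L') c (R' ++ R)
  | .node L c R, d => .node L (c.comp d) R

theorem Ctx.fill_comp (c d : Ctx) (Δ : Hedge) : (c.comp d).fill Δ = c.fill (d.fill Δ) := by
  induction c with
  | hole L R => cases d <;> simp [comp, fill]
  | node L c R ih => simp [comp, fill, ih]

open _root_.LDiamond.Tree in
/-- Closure under the rules of the calculus other than Cut. -/
structure RulesClosed (Q : Hedge → Ty → Prop) : Prop where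
  init (i : ℕ) : Q [leaf (.prim i)] (.prim i)
  underL {Δ : Ctx} {Γ : Hedge} {A B C : Ty} :
    Q Γ A → Q (Δ.fill [leaf B]) C → Q (Δ.fill (Γ ++ [leaf (.under A B)])) C
  underR {Γ : Hedge} {A B : Ty} : Γ ≠ [] → Q (leaf A :: Γ) B → Q Γ (.under A B)
  overL {Δ : Ctx} {Γ : Hedge} {A B C : Ty} :
    Q Γ A → Q (Δ.fill [leaf B]) C → Q (Δ.fill (leaf (.over B A) :: Γ)) C
  overR {Γ : Hedge} {A B : Ty} : Γ ≠ [] → Q (Γ ++ [leaf A]) B → Q Γ (.over B A)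
  prodL {Γ : Ctx} {A B C : Ty} :
    Q (Γ.fill [leaf A, leaf B]) C → Q (Γ.fill [leaf (.prod A B)]) C
  prodR {Γ Δ : Hedge} {A B : Ty} : Q Γ A → Q Δ B → Q (Γ ++ Δ) (.prod A B)
  diaL {Γ : Ctx} {A B : Ty} :
    Q (Γ.fill [node [leaf A]]) B → Q (Γ.fill [leaf (.dia A)]) B
  diaR {Γ : Hedge} {A : Ty} : Q Γ A → Q [node Γ] (.dia A)
  boxL {Γ : Ctx} {A B : Ty} :
    Q (Γ.fill [leaf A]) B → Q (Γ.fill [node [leaf (.box A)]]) B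
  boxR {Γ : Hedge} {A : Ty} : Γ ≠ [] → Q [node Γ] A → Q Γ (.box A)

section Semantics

variable (Q : Hedge → Ty → Prop)

/-- The closure of a set of hedges with respect to all tests by contexts and succedents. -/
def clos (X : Set Hedge) : Set Hedge :=
  {Γ | Γ ≠ [] ∧ ∀ (c : Ctx) (C : Ty), (∀ Δ ∈ X, Q (c.fill Δ) C) → Q (c.fill Γ) C}

/-- The interpretation of a type as a set of hedges. -/
def sem : Ty → Set Hedge
  | .prim i => {Γ | Γ ≠ [] ∧ Q Γ (.prim i)}
  | .under A B => {Γ | Γ ≠ [] ∧ ∀ Δ ∈ sem A, Δ ++ Γ ∈ sem B}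
  | .over B A => {Γ | Γ ≠ [] ∧ ∀ Δ ∈ sem A, Γ ++ Δ ∈ sem B}
  | .prod A B => clos Q {Γ | ∃ Δ₁ ∈ sem A, ∃ Δ₂ ∈ sem B, Γ = Δ₁ ++ Δ₂}
  | .dia A => clos Q {Γ | ∃ Δ ∈ sem A, Γ = [Tree.node Δ]}
  | .box A => {Γ | Γ ≠ [] ∧ [Tree.node Γ] ∈ sem A}

mutual

/-- The interpretation of a tree. -/
def Tree.sem : Tree → Set Hedge
  | .leaf A => LDiamond.sem Q A
  | .node Γ => {Δ | ∃ Δ' ∈ hedgeSem Γ, Δ = [Tree.node Δ']}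

/-- The interpretation of a hedge. -/
def hedgeSem : List Tree → Set Hedge
  | [] => {[]}
  | T :: Γ => {Δ | ∃ Δ₁ ∈ T.sem, ∃ Δ₂ ∈ hedgeSem Γ, Δ = Δ₁ ++ Δ₂}

end

variable {Q}

theorem subset_clos {X : Set Hedge} {Γ : Hedge} (h : Γ ∈ X) (hn : Γ ≠ []) : Γ ∈ clos Q X :=
  ⟨hn, fun _ _ hX => hX Γ h⟩

theorem ne_nil_of_mem_sem {A : Ty} {Γ : Hedge} (h : Γ ∈ sem Q A) : Γ ≠ [] := by
  cases A <;> exact h.1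

theorem fill_mem_clos {X Y : Set Hedge} {d : Ctx} {Γ : Hedge} (hΓ : Γ ∈ clos Q X)
    (h : ∀ Δ ∈ X, d.fill Δ ∈ Y) : d.fill Γ ∈ clos Q Y := by
  refine ⟨Ctx.fill_ne_nil hΓ.1, fun c C hc => ?_⟩
  rw [← Ctx.fill_comp]
  refine hΓ.2 _ _ fun Δ hΔ => ?_
  rw [Ctx.fill_comp]
  exact hc _ (h Δ hΔ)

theorem clos_clos {X : Set Hedge} {Γ : Hedge} (h : Γ ∈ clos Q (clos Q X)) : Γ ∈ clos Q X :=
  ⟨h.1, fun c C hc => h.2 c C fun _ hΔ => hΔ.2 c C hc⟩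

/-- A primitive type is interpreted by a single test, divisions and `□↓` by preimages of closed sets
under filling a context, and the product and `◇` by closures. -/
theorem clos_sem : {A : Ty} → {Γ : Hedge} → Γ ∈ clos Q (sem Q A) → Γ ∈ sem Q A
  | .prim i, Γ, h => by
    refine ⟨h.1, ?_⟩
    have := h.2 (.hole [] []) (.prim i) fun Δ hΔ => by simpa [Ctx.fill] using hΔ.2
    simpa [Ctx.fill] using this
  | .under A B, Γ, h => by
    refine ⟨h.1, fun Δ hΔ => clos_sem ?_⟩
    have := fill_mem_clos (d := .hole Δ []) (Y := sem Q B) h fun Γ' hΓ' => by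
      simpa [Ctx.fill] using hΓ'.2 Δ hΔ
    simpa [Ctx.fill] using this
  | .over B A, Γ, h => by
    refine ⟨h.1, fun Δ hΔ => clos_sem ?_⟩
    have := fill_mem_clos (d := .hole [] Δ) (Y := sem Q B) h fun Γ' hΓ' => by
      simpa [Ctx.fill] using hΓ'.2 Δ hΔ
    simpa [Ctx.fill] using this
  | .prod A B, Γ, h => clos_clos h
  | .dia A, Γ, h => clos_clos h
  | .box A, Γ, h => by
    refine ⟨h.1, clos_sem ?_⟩
    have := fill_mem_clos (d := .node [] (.hole [] []) []) (Y := sem Q A) h fun Γ' hΓ' => by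
      simpa [Ctx.fill] using hΓ'.2
    simpa [Ctx.fill] using this

theorem fill_mem_sem {X : Set Hedge} {d : Ctx} {Γ : Hedge} {A : Ty} (hΓ : Γ ∈ clos Q X)
    (h : ∀ Δ ∈ X, d.fill Δ ∈ sem Q A) : d.fill Γ ∈ sem Q A :=
  clos_sem (fill_mem_clos hΓ h)

theorem Ctx.fill_hole_nil (Δ : Hedge) : (Ctx.hole [] []).fill Δ = Δ := by simp [fill]

/-- Both halves are proved together, as in Okada's proof of cut elimination: left rules put the type
into its own interpretation, right rules turn membership into derivability. A division uses both
halves for its components. -/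
theorem RulesClosed.adequate (hQ : RulesClosed Q) : (A : Ty) →
    [Tree.leaf A] ∈ sem Q A ∧ ∀ Γ ∈ sem Q A, Q Γ A
  | .prim i => ⟨⟨by simp, hQ.init i⟩, fun _ h => h.2⟩
  | .under A B => by
    have hA := hQ.adequate A
    have hB := hQ.adequate B
    refine ⟨⟨by simp, fun Δ hΔ => clos_sem ⟨by simp, fun c C hc => ?_⟩⟩, fun Γ h => ?_⟩
    · exact hQ.underL (hA.2 Δ hΔ) (hc _ hB.1)
    · exact hQ.underR h.1 (hB.2 _ (h.2 _ hA.1))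
  | .over B A => by
    have hA := hQ.adequate A
    have hB := hQ.adequate B
    refine ⟨⟨by simp, fun Δ hΔ => clos_sem ⟨by simp, fun c C hc => ?_⟩⟩, fun Γ h => ?_⟩
    · exact hQ.overL (hA.2 Δ hΔ) (hc _ hB.1)
    · exact hQ.overR h.1 (hB.2 _ (h.2 _ hA.1))
  | .prod A B => by
    have hA := hQ.adequate A
    have hB := hQ.adequate B
    refine ⟨⟨by simp, fun c C hc => hQ.prodL (hc _ ⟨_, hA.1, _, hB.1, rfl⟩)⟩, fun Γ h => ?_⟩
    rw [← Ctx.fill_hole_nil Γ]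
    refine h.2 _ _ ?_
    rintro _ ⟨Δ₁, h1, Δ₂, h2, rfl⟩
    rw [Ctx.fill_hole_nil]
    exact hQ.prodR (hA.2 _ h1) (hB.2 _ h2)
  | .dia A => by
    have hA := hQ.adequate A
    refine ⟨⟨by simp, fun c C hc => hQ.diaL (hc _ ⟨_, hA.1, rfl⟩)⟩, fun Γ h => ?_⟩
    rw [← Ctx.fill_hole_nil Γ]
    refine h.2 _ _ ?_
    rintro _ ⟨Δ, h1, rfl⟩
    rw [Ctx.fill_hole_nil]
    exact hQ.diaR (hA.2 _ h1)
  | .box A => by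
    have hA := hQ.adequate A
    refine ⟨⟨by simp, clos_sem ⟨by simp, fun c C hc => hQ.boxL (hc _ hA.1)⟩⟩, fun Γ h => ?_⟩
    exact hQ.boxR h.1 (hA.2 _ h.2)

mutual

theorem RulesClosed.mem_treeSem (hQ : RulesClosed Q) : (T : Tree) → [T] ∈ T.sem Q
  | .leaf A => by rw [Tree.sem]; exact (hQ.adequate A).1
  | .node Γ => by rw [Tree.sem]; exact ⟨Γ, hQ.mem_hedgeSem Γ, rfl⟩

theorem RulesClosed.mem_hedgeSem (hQ : RulesClosed Q) : (Γ : List Tree) → Γ ∈ hedgeSem Q Γ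
  | [] => by rw [hedgeSem]; rfl
  | T :: Γ => by rw [hedgeSem]; exact ⟨_, hQ.mem_treeSem T, _, hQ.mem_hedgeSem Γ, rfl⟩

end

theorem hedgeSem_append {Γ Δ Θ : Hedge} :
    Θ ∈ hedgeSem Q (Γ ++ Δ) ↔ ∃ Θ₁ ∈ hedgeSem Q Γ, ∃ Θ₂ ∈ hedgeSem Q Δ, Θ = Θ₁ ++ Θ₂ := by
  induction Γ generalizing Θ with
  | nil => simp [hedgeSem]
  | cons T Γ ih =>
    simp only [List.cons_append, hedgeSem, Set.mem_ofPred_eq, ih]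
    constructor
    · rintro ⟨a, ha, _, ⟨b, hb, c, hc, rfl⟩, rfl⟩
      exact ⟨_, ⟨a, ha, b, hb, rfl⟩, c, hc, by simp⟩
    · rintro ⟨_, ⟨a, ha, b, hb, rfl⟩, c, hc, rfl⟩
      exact ⟨a, ha, _, ⟨b, hb, c, hc, rfl⟩, by simp⟩

@[simp] theorem hedgeSem_leaf {A : Ty} : hedgeSem Q [.leaf A] = sem Q A := by
  ext Θ
  simp [hedgeSem, Tree.sem]

theorem hedgeSem_node {Γ Θ : Hedge} :
    Θ ∈ hedgeSem Q [.node Γ] ↔ ∃ Δ ∈ hedgeSem Q Γ, Θ = [.node Δ] := by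
  simp [hedgeSem, Tree.sem]

theorem hedgeSem_ne_nil {Γ Θ : Hedge} (hΓ : Γ ≠ []) (h : Θ ∈ hedgeSem Q Γ) : Θ ≠ [] := by
  rcases Γ with - | ⟨T, Γ⟩
  · exact absurd rfl hΓ
  rw [hedgeSem] at h
  obtain ⟨a, ha, b, -, rfl⟩ := h
  cases T with
  | leaf A =>
    rw [Tree.sem] at ha
    simp [ne_nil_of_mem_sem ha]
  | node Δ =>
    rw [Tree.sem] at ha
    obtain ⟨c, -, rfl⟩ := ha
    simp

/-- An element of the interpretation of a filled context splits off a context `d` that does not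
depend on the filling; refilling `d` lets the left rules and Cut act at the hole. -/
theorem hedgeSem_fill {c : Ctx} {Δ Θ : Hedge} (h : Θ ∈ hedgeSem Q (c.fill Δ)) :
    ∃ d : Ctx, ∃ Δ' ∈ hedgeSem Q Δ, Θ = d.fill Δ' ∧
      ∀ Δ₁, ∀ Δ₂ ∈ hedgeSem Q Δ₁, d.fill Δ₂ ∈ hedgeSem Q (c.fill Δ₁) := by
  induction c generalizing Θ with
  | hole L R =>
    obtain ⟨_, h', r, hr, rfl⟩ := hedgeSem_append.1 h
    obtain ⟨l, hl, Δ', hΔ, rfl⟩ := hedgeSem_append.1 h'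
    refine ⟨.hole l r, Δ', hΔ, rfl, fun Δ₁ Δ₂ h2 => ?_⟩
    exact hedgeSem_append.2 ⟨_, hedgeSem_append.2 ⟨_, hl, _, h2, rfl⟩, _, hr, rfl⟩
  | node L c R ih =>
    obtain ⟨_, h', r, hr, rfl⟩ := hedgeSem_append.1 h
    obtain ⟨l, hl, n, hn, rfl⟩ := hedgeSem_append.1 h'
    obtain ⟨Θ', hΘ, rfl⟩ := hedgeSem_node.1 hn
    obtain ⟨d, Δ', hΔ, rfl, hd⟩ := ih hΘ
    refine ⟨.node l d r, Δ', hΔ, rfl, fun Δ₁ Δ₂ h2 => ?_⟩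
    exact hedgeSem_append.2 ⟨_, hedgeSem_append.2 ⟨_, hl, _,
      hedgeSem_node.2 ⟨_, hd _ _ h2, rfl⟩, rfl⟩, _, hr, rfl⟩

/-- Soundness holds for an arbitrary `Q`, and Cut is among the sound rules: it is the composition of
two inclusions. Combined with adequacy this removes Cut. -/
theorem Provable.mem_sem {s : Sequent} (h : Provable s) :
    ∀ Θ ∈ hedgeSem Q s.antecedent, Θ ∈ sem Q s.succedent := by
  induction h with
  | init i => intro Θ h; simpa using h
  | underL _ _ h1 h2 =>
    intro Θ h
    obtain ⟨d, Δ', hΔ, rfl, hd⟩ := hedgeSem_fill h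
    obtain ⟨a, ha, b, hb, rfl⟩ := hedgeSem_append.1 hΔ
    refine h2 _ (hd _ _ ?_)
    rw [hedgeSem_leaf] at hb ⊢
    exact hb.2 _ (h1 _ ha)
  | underR hn _ ih =>
    intro Θ h
    refine ⟨hedgeSem_ne_nil hn h, fun Δ hΔ => ih _ ?_⟩
    exact hedgeSem_append (Γ := [_]).2 ⟨_, by rwa [hedgeSem_leaf], _, h, rfl⟩
  | overL _ _ h1 h2 =>
    intro Θ h
    obtain ⟨d, Δ', hΔ, rfl, hd⟩ := hedgeSem_fill h
    obtain ⟨a, ha, b, hb, rfl⟩ := hedgeSem_append (Γ := [_]).1 hΔ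
    refine h2 _ (hd _ _ ?_)
    rw [hedgeSem_leaf] at ha ⊢
    exact ha.2 _ (h1 _ hb)
  | overR hn _ ih =>
    intro Θ h
    refine ⟨hedgeSem_ne_nil hn h, fun Δ hΔ => ih _ ?_⟩
    exact hedgeSem_append.2 ⟨_, h, _, by rwa [hedgeSem_leaf], rfl⟩
  | prodL _ ih =>
    intro Θ h
    obtain ⟨d, Δ', hΔ, rfl, hd⟩ := hedgeSem_fill h
    rw [hedgeSem_leaf] at hΔ
    refine fill_mem_sem hΔ ?_
    rintro _ ⟨a, ha, b, hb, rfl⟩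
    refine ih _ (hd _ _ ?_)
    exact hedgeSem_append (Γ := [_]).2 ⟨_, by rwa [hedgeSem_leaf], _, by rwa [hedgeSem_leaf], rfl⟩
  | prodR _ _ h1 h2 =>
    intro Θ h
    obtain ⟨a, ha, b, hb, rfl⟩ := hedgeSem_append.1 h
    exact subset_clos ⟨_, h1 _ ha, _, h2 _ hb, rfl⟩ (by simp [ne_nil_of_mem_sem (h1 _ ha)])
  | diaL _ ih =>
    intro Θ h
    obtain ⟨d, Δ', hΔ, rfl, hd⟩ := hedgeSem_fill h
    rw [hedgeSem_leaf] at hΔ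
    refine fill_mem_sem hΔ ?_
    rintro _ ⟨a, ha, rfl⟩
    exact ih _ (hd _ _ (hedgeSem_node.2 ⟨_, by rwa [hedgeSem_leaf], rfl⟩))
  | diaR _ ih =>
    intro Θ h
    obtain ⟨a, ha, rfl⟩ := hedgeSem_node.1 h
    exact subset_clos ⟨_, ih _ ha, rfl⟩ (by simp)
  | boxL _ ih =>
    intro Θ h
    obtain ⟨d, Δ', hΔ, rfl, hd⟩ := hedgeSem_fill h
    obtain ⟨a, ha, rfl⟩ := hedgeSem_node.1 hΔ
    rw [hedgeSem_leaf] at ha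
    exact ih _ (hd _ _ (by rw [hedgeSem_leaf]; exact ha.2))
  | boxR hp ih =>
    intro Θ h
    exact ⟨hedgeSem_ne_nil hp.good.2.1.1 h, ih _ (hedgeSem_node.2 ⟨_, h, rfl⟩)⟩
  | cut _ _ h1 h2 =>
    intro Θ h
    obtain ⟨d, Δ', hΔ, rfl, hd⟩ := hedgeSem_fill h
    exact h2 _ (hd _ _ (by rw [hedgeSem_leaf]; exact h1 _ hΔ))

/-- Cut is admissible: every relation closed under the other rules contains all provable
sequents. -/
theorem RulesClosed.of_provable (hQ : RulesClosed Q) {Γ : Hedge} {C : Ty}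
    (h : Provable (Γ ⇒ C)) : Q Γ C :=
  (hQ.adequate C).2 _ (h.mem_sem _ (hQ.mem_hedgeSem Γ))

end Semantics

end LDiamond

-- Hedges as strings, erasure and renaming of decorations

namespace LDiamond

mutual

/-- The string that represents a tree. -/
def Tree.flat : Tree → List (Tok Ty Unit)
  | .leaf A => [.leaf A]
  | .node Γ => .op () :: (hedgeFlat Γ ++ [.cl ()])

/-- The string that represents a hedge. -/
def hedgeFlat : List Tree → List (Tok Ty Unit)
  | [] => []
  | T :: Γ => T.flat ++ hedgeFlat Γ

end

@[simp] theorem hedgeFlat_nil : hedgeFlat [] = [] := by rw [hedgeFlat]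

@[simp] theorem hedgeFlat_cons (T : Tree) (Γ : Hedge) :
    hedgeFlat (T :: Γ) = T.flat ++ hedgeFlat Γ := by rw [hedgeFlat]

@[simp] theorem Tree.flat_leaf (A : Ty) : (Tree.leaf A).flat = [.leaf A] := by rw [Tree.flat]

@[simp] theorem Tree.flat_node (Γ : Hedge) :
    (Tree.node Γ).flat = .op () :: (hedgeFlat Γ ++ [.cl ()]) := by rw [Tree.flat]

@[simp] theorem hedgeFlat_append (Γ Δ : Hedge) :
    hedgeFlat (Γ ++ Δ) = hedgeFlat Γ ++ hedgeFlat Δ := by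
  induction Γ with
  | nil => simp
  | cons T Γ ih => simp [ih]

mutual

theorem Tree.bal_flat : (T : Tree) → Bal T.flat
  | .leaf A => by simp
  | .node Γ => by rw [Tree.flat_node]; exact (bal_hedgeFlat Γ).wrap ()

theorem bal_hedgeFlat : (Γ : List Tree) → Bal (hedgeFlat Γ)
  | [] => by simp
  | T :: Γ => by rw [hedgeFlat_cons]; exact T.bal_flat.append (bal_hedgeFlat Γ)

end

theorem Ctx.flat_fill (c : Ctx) :
    ∃ L R, ∀ Δ, hedgeFlat (c.fill Δ) = L ++ (hedgeFlat Δ ++ R) := by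
  induction c with
  | hole L R => exact ⟨hedgeFlat L, hedgeFlat R, fun Δ => by simp [fill]⟩
  | node L c R ih =>
    obtain ⟨L', R', h⟩ := ih
    exact ⟨hedgeFlat L ++ .op () :: L', R' ++ .cl () :: hedgeFlat R, fun Δ => by simp [fill, h]⟩

/-- Removal of the decoration. -/
def DTy.erase : DTy → Ty
  | .prim p _ => .prim p
  | .ldiv A B => .under A.erase B.erase
  | .rdiv B A => .over B.erase A.erase
  | .prod A B => .prod A.erase B.erase
  | .dia _ A => .dia A.erase
  | .box _ A => .box A.erase

/-- Removal of the decoration. -/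
def Tok.erase : Tok DTy ℕ → Tok Ty Unit
  | .leaf A => .leaf A.erase
  | .op _ => .op ()
  | .cl _ => .cl ()

theorem Tok.erase_eq_leaf {a : Tok DTy ℕ} {A : Ty} (h : a.erase = .leaf A) :
    ∃ B : DTy, a = .leaf B ∧ B.erase = A := by
  cases a with
  | leaf B => cases h; exact ⟨B, rfl, rfl⟩
  | op i => cases h
  | cl i => cases h

theorem Tok.erase_eq_op {a : Tok DTy ℕ} {u : Unit} (h : a.erase = .op u) : ∃ i, a = .op i := by
  cases a with
  | leaf B => cases h
  | op i => exact ⟨i, rfl⟩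
  | cl i => cases h

theorem Tok.erase_eq_cl {a : Tok DTy ℕ} {u : Unit} (h : a.erase = .cl u) : ∃ i, a = .cl i := by
  cases a with
  | leaf B => cases h
  | op i => cases h
  | cl i => exact ⟨i, rfl⟩

theorem Runs.erase {X : Str} {s t : List ℕ} (h : Runs X s t) :
    Runs (X.map Tok.erase) (s.map fun _ => ()) (t.map fun _ => ()) := by
  induction X generalizing s with
  | nil => exact congrArg _ h
  | cons a X ih =>
    cases a with
    | leaf A => exact ih h
    | op i => exact ih (s := i :: s) h
    | cl i =>
      obtain ⟨s', rfl, h⟩ := h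
      exact ⟨_, rfl, ih h⟩

/-- Whether a run reaches below `s` depends only on the shape of the brackets. If the erased string
stays above, the indexed one never touches `u`. -/
theorem Runs.exists_of_erase {X : Str} {s u w : List ℕ} {t : List Unit} (h : Runs X (s ++ u) w)
    (h' : Runs (X.map Tok.erase) (s.map fun _ => ()) t) : ∃ v, Runs X s v := by
  induction X generalizing s with
  | nil => exact ⟨s, rfl⟩
  | cons a X ih =>
    cases a with
    | leaf A => exact ih h h'
    | op i => exact ih (s := i :: s) h h'
    | cl i =>
      rcases s with - | ⟨j, s⟩
      · obtain ⟨s', e, -⟩ := h'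
        cases e
      · obtain ⟨s', e, h⟩ := h
        obtain ⟨s'', e', h'⟩ := h'
        cases e
        cases e'
        obtain ⟨v, hv⟩ := ih h h'
        exact ⟨v, s, rfl, hv⟩

theorem Bal.erase {X : Str} (h : Bal X) : Bal (X.map Tok.erase) := Runs.erase h

/-- Recovers the side condition of the decorated right rule for `□↓`, and the equality of the two
outer indices, from the undecorated hedge. -/
theorem Bal.of_erase {X : Str} {i j : ℕ} (h : Bal (.op i :: (X ++ [.cl j])))
    (h' : Bal (X.map Tok.erase)) : i = j ∧ Bal X := by
  obtain ⟨w, h1, -⟩ := runs_append.1 h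
  obtain ⟨v, hv⟩ := Runs.exists_of_erase (s := []) h1 h'
  have e := Runs.det (Runs.erase hv) h'
  rw [List.map_eq_nil_iff] at e
  subst e
  exact ⟨(Bal.unwrap (R := []) hv h).1, hv⟩

/-- Renaming of tags and indices. -/
def DTy.map (f : ℕ → ℕ) : DTy → DTy
  | .prim p k => .prim p (f k)
  | .ldiv A B => .ldiv (A.map f) (B.map f)
  | .rdiv B A => .rdiv (B.map f) (A.map f)
  | .prod A B => .prod (A.map f) (B.map f)
  | .dia i A => .dia (f i) (A.map f)
  | .box i A => .box (f i) (A.map f)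

/-- Renaming of tags and indices. -/
def Tok.map (f : ℕ → ℕ) : Tok DTy ℕ → Tok DTy ℕ
  | .leaf A => .leaf (A.map f)
  | .op i => .op (f i)
  | .cl i => .cl (f i)

/-- Renaming of tags and indices. -/
def Letter.map (f : ℕ → ℕ) : Letter → Letter
  | .pr p k => .pr p (f k)
  | .op i => .op (f i)
  | .cl i => .cl (f i)

theorem DTy.erase_map (f : ℕ → ℕ) (A : DTy) : (A.map f).erase = A.erase := by
  induction A <;> simp [map, erase, *]

theorem Tok.erase_comp_map (f : ℕ → ℕ) : Tok.erase ∘ Tok.map f = Tok.erase := by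
  funext a
  cases a <;> simp [map, erase, DTy.erase_map]

theorem Runs.map {X : Str} {s t : List ℕ} (f : ℕ → ℕ) (h : Runs X s t) :
    Runs (X.map (Tok.map f)) (s.map f) (t.map f) := by
  induction X generalizing s with
  | nil => exact congrArg _ h
  | cons a X ih =>
    cases a with
    | leaf A => exact ih h
    | op i => exact ih (s := i :: s) h
    | cl i =>
      obtain ⟨s', rfl, h⟩ := h
      exact ⟨_, rfl, ih h⟩

theorem DP.map {Γ : Str} {C : DTy} (f : ℕ → ℕ) (h : DP Γ C) :
    DP (Γ.map (Tok.map f)) (C.map f) := by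
  induction h with
  | init p k => exact .init p (f k)
  | underL _ _ h1 h2 =>
    simp only [List.map_append, List.map_cons] at h2 ⊢
    exact .underL h1 h2
  | underR hn _ h => exact .underR (by simpa using hn) h
  | overL _ _ h1 h2 =>
    simp only [List.map_append, List.map_cons] at h2 ⊢
    exact .overL h1 h2
  | overR hn _ h =>
    simp only [List.map_append, List.map_cons] at h
    exact .overR (by simpa using hn) h
  | prodL _ h =>
    simp only [List.map_append, List.map_cons] at h ⊢
    exact .prodL h
  | prodR _ _ h1 h2 =>
    rw [List.map_append]
    exact .prodR h1 h2
  | diaL _ h =>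
    simp only [List.map_append, List.map_cons] at h ⊢
    exact .diaL h
  | diaR _ h =>
    simp only [List.map_append, List.map_cons]
    exact .diaR h
  | boxL _ h =>
    simp only [List.map_append, List.map_cons] at h ⊢
    exact .boxL h
  | boxR hb hn _ h =>
    simp only [List.map_append, List.map_cons] at h
    exact .boxR (Runs.map f hb) (by simpa using hn) h

section Rename

variable {f : ℕ → ℕ}

theorem DTy.cnt_map_of_notMem {x : Letter} (hx : ∀ y, x ≠ Letter.map f y) (A : DTy) :
    (A.map f).cnt x = 0 := by
  have hp : ∀ p k, x.ind (.pr p (f k)) = 0 := fun p k => if_neg (hx (.pr p k))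
  have ho : ∀ i, x.ind (.op (f i)) = 0 := fun i => if_neg (hx (.op i))
  have hc : ∀ i, x.ind (.cl (f i)) = 0 := fun i => if_neg (hx (.cl i))
  induction A <;> simp [map, cnt, *]

theorem cntL_map_of_notMem {x : Letter} (hx : ∀ y, x ≠ Letter.map f y) (X : Str) :
    cntL x (X.map (Tok.map f)) = 0 := by
  have ho : ∀ i, x.ind (.op (f i)) = 0 := fun i => if_neg (hx (.op i))
  have hc : ∀ i, x.ind (.cl (f i)) = 0 := fun i => if_neg (hx (.cl i))
  induction X with
  | nil => rfl
  | cons a X ih => cases a <;> simp [Tok.map, Tok.cnt, DTy.cnt_map_of_notMem hx, *]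

theorem Letter.map_injective (hf : f.Injective) : (Letter.map f).Injective := by
  intro a b h
  cases a <;> cases b <;> simp_all [Letter.map, hf.eq_iff]

theorem Letter.ind_map (hf : f.Injective) (x y : Letter) : (x.map f).ind (y.map f) = x.ind y := by
  simp [ind, (map_injective hf).eq_iff]

theorem DTy.cnt_map (hf : f.Injective) (x : Letter) (A : DTy) :
    (A.map f).cnt (x.map f) = A.cnt x := by
  have hp : ∀ p k, (x.map f).ind (.pr p (f k)) = x.ind (.pr p k) :=
    fun p k => Letter.ind_map hf x (.pr p k)
  have ho : ∀ i, (x.map f).ind (.op (f i)) = x.ind (.op i) := fun i => Letter.ind_map hf x (.op i)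
  have hc : ∀ i, (x.map f).ind (.cl (f i)) = x.ind (.cl i) := fun i => Letter.ind_map hf x (.cl i)
  induction A <;> simp [map, cnt, *]

theorem cntL_map (hf : f.Injective) (x : Letter) (X : Str) :
    cntL (x.map f) (X.map (Tok.map f)) = cntL x X := by
  have ho : ∀ i, (x.map f).ind (.op (f i)) = x.ind (.op i) := fun i => Letter.ind_map hf x (.op i)
  have hc : ∀ i, (x.map f).ind (.cl (f i)) = x.ind (.cl i) := fun i => Letter.ind_map hf x (.cl i)
  induction X with
  | nil => rfl
  | cons a X ih => cases a <;> simp [Tok.map, Tok.cnt, DTy.cnt_map hf, *]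

end Rename

-- Thin decorations of provable sequents

/-- Every letter occurs at most twice. -/
def Thin (X : Str) (D : DTy) : Prop := ∀ x, cntL x X + D.cnt x ≤ 2

theorem Thin.map_bound {X : Str} {D : DTy} (h : Thin X D) {f : ℕ → ℕ} (hf : f.Injective)
    (x : Letter) : cntL x (X.map (Tok.map f)) + (D.map f).cnt x ≤ 2 ∧
      ((∀ y, x ≠ Letter.map f y) → cntL x (X.map (Tok.map f)) + (D.map f).cnt x = 0) := by
  refine ⟨?_, fun hx => by rw [cntL_map_of_notMem hx, DTy.cnt_map_of_notMem hx]⟩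
  by_cases hx : ∃ y, x = Letter.map f y
  · obtain ⟨y, rfl⟩ := hx
    rw [cntL_map hf, DTy.cnt_map hf]
    exact h y
  · push Not at hx
    rw [cntL_map_of_notMem hx, DTy.cnt_map_of_notMem hx]
    omega

/-- The sequent `Γ ⇒ C` comes from a thin derivable decorated sequent. -/
def Lift (Γ : Hedge) (C : Ty) : Prop :=
  ∃ (X : Str) (D : DTy), DP X D ∧ Thin X D ∧ X.map Tok.erase = hedgeFlat Γ ∧ D.erase = C

theorem Lift.disjoint {Γ Δ : Hedge} {A B : Ty} (h1 : Lift Γ A) (h2 : Lift Δ B) :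
    ∃ (X : Str) (D : DTy) (Y : Str) (E : DTy), DP X D ∧ DP Y E ∧
      (∀ x, cntL x X + D.cnt x + (cntL x Y + E.cnt x) ≤ 2) ∧
      X.map Tok.erase = hedgeFlat Γ ∧ D.erase = A ∧
      Y.map Tok.erase = hedgeFlat Δ ∧ E.erase = B := by
  obtain ⟨X, D, d1, t1, e1, e1'⟩ := h1
  obtain ⟨Y, E, d2, t2, e2, e2'⟩ := h2
  -- Even tags for one premise and odd ones for the other make the letters disjoint, so the joint
  -- count stays at most two.
  have hf : (fun k : ℕ => 2 * k).Injective := fun a b h => by simpa using h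
  have hg : (fun k : ℕ => 2 * k + 1).Injective := fun a b h => by simpa using h
  refine ⟨_, _, _, _, d1.map (fun k => 2 * k), d2.map (fun k => 2 * k + 1), fun x => ?_,
    ?_, ?_, ?_, ?_⟩
  · obtain ⟨b1, c1⟩ := t1.map_bound hf x
    obtain ⟨b2, c2⟩ := t2.map_bound hg x
    by_cases hx : ∀ y, x ≠ Letter.map (fun k => 2 * k) y
    · rw [c1 hx]
      omega
    · push Not at hx
      obtain ⟨y, rfl⟩ := hx
      rw [c2]
      · omega
      · intro z h
        cases y <;> cases z <;> simp [Letter.map] at h <;> omega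
  · rw [List.map_map, Tok.erase_comp_map, e1]
  · rw [DTy.erase_map, e1']
  · rw [List.map_map, Tok.erase_comp_map, e2]
  · rw [DTy.erase_map, e2']

/-- Shifting all tags frees the index 0. The factor 2 reserves room for its use both in a new
bracket and in the new modality. -/
theorem Lift.fresh {Γ : Hedge} {A : Ty} (h : Lift Γ A) :
    ∃ (X : Str) (D : DTy), DP X D ∧
      (∀ x : Letter, cntL x X + D.cnt x + 2 * (x.ind (.op 0) + x.ind (.cl 0)) ≤ 2) ∧
      X.map Tok.erase = hedgeFlat Γ ∧ D.erase = A := by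
  obtain ⟨X, D, d, t, e, e'⟩ := h
  have hf : Nat.succ.Injective := Nat.succ_injective
  refine ⟨_, _, d.map Nat.succ, fun x => ?_, ?_, ?_⟩
  · obtain ⟨b, c⟩ := t.map_bound hf x
    by_cases h1 : x = .op 0
    · rw [c (fun y => by subst h1; cases y <;> simp [Letter.map])]
      simp [h1, Letter.ind]
    by_cases h2 : x = .cl 0
    · rw [c (fun y => by subst h2; cases y <;> simp [Letter.map])]
      simp [h2, Letter.ind]
    simpa [Letter.ind, h1, h2] using b
  · rw [List.map_map, Tok.erase_comp_map, e]
  · rw [DTy.erase_map, e']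

theorem map_erase_eq_append {X : Str} {L M R : List (Tok Ty Unit)}
    (h : X.map Tok.erase = L ++ (M ++ R)) :
    ∃ L' M' R' : Str, X = L' ++ (M' ++ R') ∧ L'.map Tok.erase = L ∧ M'.map Tok.erase = M ∧
      R'.map Tok.erase = R := by
  obtain ⟨L', X', rfl, h1, h2⟩ := List.map_eq_append_iff.1 h
  obtain ⟨M', R', rfl, h3, h4⟩ := List.map_eq_append_iff.1 h2
  exact ⟨L', M', R', rfl, h1, h3, h4⟩

theorem map_erase_eq_leaf {X : Str} {A : Ty} (h : X.map Tok.erase = [.leaf A]) :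
    ∃ B : DTy, X = [.leaf B] ∧ B.erase = A := by
  obtain ⟨a, rfl, h'⟩ := List.map_eq_singleton_iff.1 h
  obtain ⟨B, rfl, rfl⟩ := Tok.erase_eq_leaf h'
  exact ⟨B, rfl, rfl⟩

theorem map_erase_eq_bracket {X : Str} {Y : List (Tok Ty Unit)}
    (h : X.map Tok.erase = .op () :: (Y ++ [.cl ()])) :
    ∃ (i : ℕ) (Y' : Str) (j : ℕ), X = .op i :: (Y' ++ [.cl j]) ∧ Y'.map Tok.erase = Y := by
  obtain ⟨a, X', rfl, h1, h2⟩ := List.map_eq_cons_iff.1 h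
  obtain ⟨Y', Z, rfl, h3, h4⟩ := List.map_eq_append_iff.1 h2
  obtain ⟨b, rfl, h5⟩ := List.map_eq_singleton_iff.1 h4
  obtain ⟨i, rfl⟩ := Tok.erase_eq_op h1
  obtain ⟨j, rfl⟩ := Tok.erase_eq_cl h5
  exact ⟨i, Y', j, rfl, h3⟩

/-- An initial sequent uses its tag twice, and the rules that pair a new bracket with a modality use
a fresh index twice. The other rules only move letters around. Cut would not fit: the two
decorations of the cut type need not agree. -/
theorem Lift.rulesClosed : RulesClosed Lift where
  init i := ⟨_, _, .init i 0, fun x => by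
    simp only [cntL_cons, cntL_nil, Tok.cnt, DTy.cnt, Letter.ind]
    split <;> omega, by simp [Tok.erase, DTy.erase], rfl⟩
  underL {c Γ A B C} h1 h2 := by
    obtain ⟨X, D, Y, E, d1, d2, ht, e1, rfl, e2, rfl⟩ := h1.disjoint h2
    obtain ⟨L, R, hc⟩ := c.flat_fill
    rw [hc] at e2
    obtain ⟨L', M', R', rfl, rfl, e3, rfl⟩ := map_erase_eq_append e2
    obtain ⟨B', rfl, rfl⟩ := map_erase_eq_leaf (by simpa using e3)
    refine ⟨_, _, .underL d1 d2, fun x => ?_, ?_, rfl⟩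
    · have := ht x
      simp [Tok.cnt, DTy.cnt] at this ⊢; omega
    · rw [hc]
      simp [e1, Tok.erase, DTy.erase]
  underR {Γ A B} hn h := by
    obtain ⟨X, D, d, ht, e, rfl⟩ := h
    obtain ⟨L', M', R', rfl, e1, e2, e3⟩ := map_erase_eq_append (L := []) (M := [.leaf A])
      (R := hedgeFlat Γ) (by simpa using e)
    obtain rfl := List.map_eq_nil_iff.1 e1
    obtain ⟨A', rfl, rfl⟩ := map_erase_eq_leaf e2
    have hR : R' ≠ [] := by
      rintro rfl
      rcases Γ with - | ⟨T, Γ⟩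
      · exact hn rfl
      · cases T <;> simp at e3
    refine ⟨_, _, .underR hR d, fun x => ?_, e3, rfl⟩
    have := ht x
    simp [Tok.cnt, DTy.cnt] at this ⊢; omega
  overL {c Γ A B C} h1 h2 := by
    obtain ⟨X, D, Y, E, d1, d2, ht, e1, rfl, e2, rfl⟩ := h1.disjoint h2
    obtain ⟨L, R, hc⟩ := c.flat_fill
    rw [hc] at e2
    obtain ⟨L', M', R', rfl, rfl, e3, rfl⟩ := map_erase_eq_append e2
    obtain ⟨B', rfl, rfl⟩ := map_erase_eq_leaf (by simpa using e3)
    refine ⟨_, _, .overL d1 d2, fun x => ?_, ?_, rfl⟩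
    · have := ht x
      simp [Tok.cnt, DTy.cnt] at this ⊢; omega
    · rw [hc]
      simp [e1, Tok.erase, DTy.erase]
  overR {Γ A B} hn h := by
    obtain ⟨X, D, d, ht, e, rfl⟩ := h
    obtain ⟨L', M', R', rfl, e1, e2, e3⟩ := map_erase_eq_append (L := hedgeFlat Γ) (M := [.leaf A])
      (R := []) (by simpa using e)
    obtain rfl := List.map_eq_nil_iff.1 e3
    obtain ⟨A', rfl, rfl⟩ := map_erase_eq_leaf e2
    have hL : L' ≠ [] := by
      rintro rfl
      rcases Γ with - | ⟨T, Γ⟩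
      · exact hn rfl
      · cases T <;> simp at e1
    refine ⟨_, _, .overR hL d, fun x => ?_, e1, rfl⟩
    have := ht x
    simp [Tok.cnt, DTy.cnt] at this ⊢; omega
  prodL {c A B C} h := by
    obtain ⟨X, D, d, ht, e, rfl⟩ := h
    obtain ⟨L, R, hc⟩ := c.flat_fill
    rw [hc] at e
    obtain ⟨L', M', R', rfl, rfl, e2, rfl⟩ := map_erase_eq_append e
    obtain ⟨a, b, rfl, h1, h2⟩ : ∃ a b, M' = [a, b] ∧ a.erase = .leaf A ∧ b.erase = .leaf B := by
      simpa [List.map_eq_cons_iff, and_assoc] using e2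
    obtain ⟨A', rfl, rfl⟩ := Tok.erase_eq_leaf h1
    obtain ⟨B', rfl, rfl⟩ := Tok.erase_eq_leaf h2
    refine ⟨_, _, .prodL d, fun x => ?_, ?_, rfl⟩
    · have := ht x
      simp [Tok.cnt, DTy.cnt] at this ⊢; omega
    · rw [hc]
      simp [Tok.erase, DTy.erase]
  prodR {Γ Δ A B} h1 h2 := by
    obtain ⟨X, D, Y, E, d1, d2, ht, e1, rfl, e2, rfl⟩ := h1.disjoint h2
    refine ⟨_, _, .prodR d1 d2, fun x => ?_, by simp [e1, e2], rfl⟩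
    have := ht x
    simp [DTy.cnt] at this ⊢; omega
  diaL {c A B} h := by
    obtain ⟨X, D, d, ht, e, rfl⟩ := h
    obtain ⟨L, R, hc⟩ := c.flat_fill
    rw [hc] at e
    obtain ⟨L', M', R', rfl, rfl, e2, rfl⟩ := map_erase_eq_append e
    obtain ⟨i, Y, j, rfl, e3⟩ := map_erase_eq_bracket (Y := [.leaf A]) (by simpa using e2)
    obtain ⟨A', rfl, rfl⟩ := map_erase_eq_leaf e3
    -- The premise is well-bracketed and only a leaf separates the two brackets, so they match.
    obtain rfl : i = j := by
      obtain ⟨s, -, s', e4, -⟩ := runs_append.1 d.bal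
      cases e4
      rfl
    refine ⟨_, _, .diaL d, fun x => ?_, ?_, rfl⟩
    · have := ht x
      simp [Tok.cnt, DTy.cnt] at this ⊢; omega
    · rw [hc]
      simp [Tok.erase, DTy.erase]
  diaR {Γ A} h := by
    obtain ⟨X, D, d, ht, e, rfl⟩ := h.fresh
    refine ⟨_, _, .diaR (i := 0) d, fun x => ?_, by simp [e, Tok.erase], rfl⟩
    have := ht x
    simp [Tok.cnt, DTy.cnt] at this ⊢; omega
  boxL {c A B} h := by
    obtain ⟨X, D, d, ht, e, rfl⟩ := h.fresh
    obtain ⟨L, R, hc⟩ := c.flat_fill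
    rw [hc] at e
    obtain ⟨L', M', R', rfl, rfl, e2, rfl⟩ := map_erase_eq_append e
    obtain ⟨A', rfl, rfl⟩ := map_erase_eq_leaf (by simpa using e2)
    refine ⟨_, _, .boxL (i := 0) d, fun x => ?_, ?_, rfl⟩
    · have := ht x
      simp [Tok.cnt, DTy.cnt] at this ⊢; omega
    · rw [hc]
      simp [Tok.erase, DTy.erase]
  boxR {Γ A} hn h := by
    obtain ⟨X, D, d, ht, e, rfl⟩ := h
    obtain ⟨i, Y, j, rfl, e3⟩ := map_erase_eq_bracket (Y := hedgeFlat Γ) (by simpa using e)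
    obtain ⟨rfl, hb⟩ := d.bal.of_erase (by rw [e3]; exact bal_hedgeFlat Γ)
    have hY : Y ≠ [] := by
      rintro rfl
      rcases Γ with - | ⟨T, Γ⟩
      · exact hn rfl
      · cases T <;> simp at e3
    refine ⟨_, _, .boxR hb hY d, fun x => ?_, e3, rfl⟩
    have := ht x
    simp [Tok.cnt, DTy.cnt] at this ⊢; omega

end LDiamond

-- From strings back to hedges

namespace LDiamond

/-- A well-bracketed prefix cannot stop strictly inside the bracket of a tree, since that opening
bracket would stay unmatched. -/
theorem hedgeFlat_eq_append {H : Hedge} {X R : List (Tok Ty Unit)} (h : hedgeFlat H = X ++ R)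
    (hX : Bal X) : ∃ H₁ H₂, H = H₁ ++ H₂ ∧ hedgeFlat H₁ = X ∧ hedgeFlat H₂ = R := by
  induction H generalizing X with
  | nil =>
    obtain ⟨rfl, rfl⟩ := List.append_eq_nil_iff.1 h.symm
    exact ⟨[], [], rfl, rfl, rfl⟩
  | cons T H ih =>
    rcases X with - | ⟨a, X⟩
    · exact ⟨[], T :: H, rfl, rfl, h⟩
    rw [hedgeFlat_cons] at h
    rcases List.append_eq_append_iff.1 h with ⟨Z, h1, h2⟩ | ⟨Z, h1, h2⟩
    · obtain ⟨H₁, H₂, rfl, rfl, rfl⟩ := ih h2 (Bal.right T.bal_flat (h1 ▸ hX))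
      exact ⟨T :: H₁, H₂, rfl, by simp [h1], rfl⟩
    · rcases Z.eq_nil_or_concat with rfl | ⟨Z, b, rfl⟩
      · exact ⟨[T], H, rfl, by simpa using h1, by simpa using h2.symm⟩
      · exfalso
        cases T with
        | leaf A => simp at h1
        | node Γ =>
          rw [Tree.flat_node] at h1
          cases (List.cons.inj h1).1
          replace h1 : hedgeFlat Γ ++ [.cl ()] = X ++ Z.concat b := (List.cons.inj h1).2
          simp only [← List.append_assoc, List.concat_eq_append] at h1
          have e := (List.append_inj' h1 rfl).1
          exact Bal.not_op (e ▸ bal_hedgeFlat Γ) hX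

/-- A well-bracketed segment of the string of a hedge is the string of a hedge in a context. -/
theorem exists_fill_eq {H : Hedge} {L X R : List (Tok Ty Unit)}
    (h : hedgeFlat H = L ++ (X ++ R)) (hX : Bal X) :
    ∃ (c : Ctx) (M : Hedge), H = c.fill M ∧ hedgeFlat M = X ∧
      ∀ K, hedgeFlat (c.fill K) = L ++ (hedgeFlat K ++ R) := by
  induction hn : (hedgeFlat H).length using Nat.strong_induction_on generalizing H L R with
  | _ n ih =>
  rcases L with - | ⟨a, L⟩
  · obtain ⟨H₁, H₂, rfl, rfl, rfl⟩ := hedgeFlat_eq_append (X := X) h hX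
    exact ⟨.hole [] H₂, H₁, rfl, rfl, fun K => by simp [Ctx.fill]⟩
  rcases H with - | ⟨T, H⟩
  · cases h
  rw [hedgeFlat_cons] at h hn
  rw [List.length_append] at hn
  have hT : 0 < T.flat.length := by cases T <;> simp
  have past : ∀ Z, a :: L = T.flat ++ Z → hedgeFlat H = Z ++ (X ++ R) →
      ∃ (c : Ctx) (M : Hedge), T :: H = c.fill M ∧ hedgeFlat M = X ∧
        ∀ K, hedgeFlat (c.fill K) = a :: L ++ (hedgeFlat K ++ R) := by
    intro Z h1 h2
    obtain ⟨c, M, rfl, h3, h4⟩ := ih _ (by omega) h2 rfl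
    refine ⟨(Ctx.hole [T] []).comp c, M, by simp [Ctx.fill_comp, Ctx.fill], h3, fun K => ?_⟩
    rw [h1, Ctx.fill_comp]
    simp [Ctx.fill, h4]
  rcases List.append_eq_append_iff.1 h with ⟨Z, h1, h2⟩ | ⟨Z, h1, h2⟩
  · exact past Z h1 h2
  · rcases Z.eq_nil_or_concat with rfl | ⟨Z, b, rfl⟩
    · exact past [] (by simpa using h1.symm) (by simpa using h2.symm)
    cases T with
    | leaf A => simp at h1
    | node Γ =>
      rw [Tree.flat_node] at h1
      rw [Tree.flat_node, List.length_cons, List.length_append] at hn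
      cases (List.cons.inj h1).1
      replace h1 : hedgeFlat Γ ++ [.cl ()] = L ++ Z.concat b := (List.cons.inj h1).2
      simp only [← List.append_assoc, List.concat_eq_append] at h1
      obtain ⟨e, e'⟩ := List.append_inj' h1 rfl
      cases e'
      have inner : ∀ W, Z = X ++ W → R = W ++ .cl () :: hedgeFlat H →
          ∃ (c : Ctx) (M : Hedge), Tree.node Γ :: H = c.fill M ∧ hedgeFlat M = X ∧
            ∀ K, hedgeFlat (c.fill K) = .op () :: L ++ (hedgeFlat K ++ R) := by
        rintro W rfl rfl
        obtain ⟨c, M, rfl, h3, h4⟩ := ih _ (by omega) e rfl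
        refine ⟨(Ctx.node [] (.hole [] []) H).comp c, M, by simp [Ctx.fill_comp, Ctx.fill], h3,
          fun K => ?_⟩
        rw [Ctx.fill_comp]
        simp [Ctx.fill, h4]
      have h2' : X ++ R = Z ++ .cl () :: hedgeFlat H := by simpa using h2
      rcases List.append_eq_append_iff.1 h2' with ⟨W, h3, h4⟩ | ⟨W, h3, h4⟩
      · exact inner W h3 h4
      · rcases W with - | ⟨d, W⟩
        · exact inner [] (by simpa using h3.symm) (by simpa using h4.symm)
        · cases (List.cons.inj h4).1
          exact absurd (h3 ▸ hX) (Bal.not_cl (e ▸ bal_hedgeFlat Γ))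

/-- The bracket that closes the first node is determined by the string: a well-bracketed content
cannot be continued past an unmatched closing bracket. -/
theorem hedgeFlat_injective {H K : Hedge} (h : hedgeFlat H = hedgeFlat K) : H = K := by
  induction hn : (hedgeFlat H).length using Nat.strong_induction_on generalizing H K with
  | _ n ih =>
  rcases H with - | ⟨T, H⟩ <;> rcases K with - | ⟨S, K⟩
  · rfl
  · cases S <;> simp at h
  · cases T <;> simp at h
  cases T with
  | leaf A =>
    cases S with
    | leaf B =>
      simp only [hedgeFlat_cons, Tree.flat_leaf, List.singleton_append] at h
      cases (List.cons.inj h).1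
      rw [ih _ (by rw [← hn]; simp) (List.cons.inj h).2 rfl]
    | node Δ => simp at h
  | node Γ =>
    cases S with
    | leaf B => simp at h
    | node Δ =>
      simp only [hedgeFlat_cons, Tree.flat_node, List.cons_append, List.append_assoc,
        List.nil_append, List.cons.injEq, true_and] at h
      simp only [hedgeFlat_cons, Tree.flat_node, List.length_append, List.length_cons] at hn
      have e : hedgeFlat Γ = hedgeFlat Δ := by
        rcases List.append_eq_append_iff.1 h with ⟨W, h3, h4⟩ | ⟨W, h3, h4⟩ <;>
          rcases W with - | ⟨d, W⟩
        · simpa using h3.symm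
        · cases (List.cons.inj h4).1
          exact absurd (h3 ▸ bal_hedgeFlat Δ) (Bal.not_cl (X := []) (bal_hedgeFlat Γ))
        · simpa using h3
        · cases (List.cons.inj h4).1
          exact absurd (h3 ▸ bal_hedgeFlat Γ) (Bal.not_cl (X := []) (bal_hedgeFlat Δ))
      rw [e] at h
      have h' := List.append_cancel_left h
      rw [ih _ (by omega) e rfl, ih _ (by omega) (List.cons.inj h').2 rfl]

theorem exists_node_eq {H : Hedge} {X : List (Tok Ty Unit)}
    (h : hedgeFlat H = .op () :: (X ++ [.cl ()])) (hX : Bal X) :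
    ∃ M, H = [Tree.node M] ∧ hedgeFlat M = X := by
  obtain ⟨c, M, rfl, rfl, -⟩ := exists_fill_eq (L := [.op ()]) h hX
  exact ⟨M, hedgeFlat_injective (by simpa [Tok.erase] using h), rfl⟩

theorem ne_nil_of_flat {H : Hedge} {X : Str} (h : hedgeFlat H = X.map Tok.erase) (hX : X ≠ []) :
    H ≠ [] := by
  rintro rfl
  exact hX (List.map_eq_nil_iff.1 h.symm)

theorem DP.provable {X : Str} {C : DTy} (h : DP X C) :
    ∀ H, hedgeFlat H = X.map Tok.erase → Provable (H ⇒ C.erase) := by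
  induction h with
  | init p k =>
    intro H h
    rw [hedgeFlat_injective (H := H) (K := [.leaf (.prim p)])
      (by simpa [Tok.erase, DTy.erase] using h)]
    exact .init p
  | @underL L Γ R A B C d1 _ h1 h2 =>
    intro H h
    obtain ⟨c, M, rfl, hM, hc⟩ := exists_fill_eq (L := L.map Tok.erase)
      (X := Γ.map Tok.erase ++ [.leaf (DTy.ldiv A B).erase]) (R := R.map Tok.erase)
      (by simpa [Tok.erase] using h) (d1.bal.erase.append (by simp))
    obtain ⟨M₁, M₂, rfl, e1, e2⟩ := hedgeFlat_eq_append hM d1.bal.erase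
    rw [hedgeFlat_injective (H := M₂) (K := [.leaf (DTy.ldiv A B).erase]) (by simpa using e2)]
    exact .underL (h1 _ e1) (h2 _ (by rw [hc]; simp [Tok.erase]))
  | underR hn _ ih =>
    intro H h
    exact .underR (ne_nil_of_flat h hn) (ih _ (by simp [h, Tok.erase]))
  | @overL L Γ R A B C d1 _ h1 h2 =>
    intro H h
    obtain ⟨c, M, rfl, hM, hc⟩ := exists_fill_eq (L := L.map Tok.erase)
      (X := .leaf (DTy.rdiv B A).erase :: Γ.map Tok.erase) (R := R.map Tok.erase)
      (by simpa [Tok.erase] using h) d1.bal.erase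
    obtain ⟨M₁, M₂, rfl, e1, e2⟩ := hedgeFlat_eq_append
      (X := [.leaf (DTy.rdiv B A).erase]) hM (by simp)
    rw [hedgeFlat_injective (H := M₁) (K := [.leaf (DTy.rdiv B A).erase]) (by simpa using e1)]
    exact .overL (h1 _ e2) (h2 _ (by rw [hc]; simp [Tok.erase]))
  | overR hn _ ih =>
    intro H h
    exact .overR (ne_nil_of_flat h hn) (ih _ (by simp [h, Tok.erase]))
  | @prodL L R A B C _ ih =>
    intro H h
    obtain ⟨c, M, rfl, hM, hc⟩ := exists_fill_eq (L := L.map Tok.erase)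
      (X := [.leaf (DTy.prod A B).erase]) (R := R.map Tok.erase) (by simpa [Tok.erase] using h)
      (by simp)
    rw [hedgeFlat_injective (H := M) (K := [.leaf (DTy.prod A B).erase]) (by simpa using hM)]
    exact .prodL (ih _ (by rw [hc]; simp [Tok.erase]))
  | prodR d1 d2 h1 h2 =>
    intro H h
    rw [List.map_append] at h
    obtain ⟨M₁, M₂, rfl, e1, e2⟩ := hedgeFlat_eq_append h d1.bal.erase
    exact .prodR (h1 _ e1) (h2 _ e2)
  | @diaL L R i A C _ ih =>
    intro H h
    obtain ⟨c, M, rfl, hM, hc⟩ := exists_fill_eq (L := L.map Tok.erase)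
      (X := [.leaf (DTy.dia i A).erase]) (R := R.map Tok.erase) (by simpa [Tok.erase] using h)
      (by simp)
    rw [hedgeFlat_injective (H := M) (K := [.leaf (DTy.dia i A).erase]) (by simpa using hM)]
    exact .diaL (ih _ (by rw [hc]; simp [Tok.erase]))
  | diaR d ih =>
    intro H h
    obtain ⟨M, rfl, e⟩ := exists_node_eq (by simpa [Tok.erase] using h) d.bal.erase
    exact .diaR (ih _ e)
  | @boxL L R i A C _ ih =>
    intro H h
    obtain ⟨c, M, rfl, hM, hc⟩ := exists_fill_eq (L := L.map Tok.erase)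
      (X := [.op (), .leaf (DTy.box i A).erase, .cl ()]) (R := R.map Tok.erase)
      (by simpa [Tok.erase] using h) (Bal.wrap (X := [.leaf (DTy.box i A).erase]) (by simp) ())
    rw [hedgeFlat_injective (H := M) (K := [.node [.leaf (DTy.box i A).erase]])
      (by simpa using hM)]
    exact .boxL (ih _ (by rw [hc]; simp [Tok.erase]))
  | boxR _ _ _ ih =>
    intro H h
    exact .boxR (ih _ (by simp [h, Tok.erase]))

/-- A derivable sequent that represents a hedge contains no empty bracket. -/
theorem DP.not_empty_bracket {L R : Str} {i j : ℕ} {C : DTy} (d : DP (L ++ .op i :: .cl j :: R) C)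
    {H : Hedge} (h : hedgeFlat H = (L ++ .op i :: .cl j :: R).map Tok.erase) : False := by
  have hg := (d.provable H h).good.2
  obtain ⟨c, M, rfl, hM, -⟩ := exists_fill_eq (L := L.map Tok.erase)
      (X := [.op (), .cl ()]) (R := R.map Tok.erase) (by simpa [Tok.erase] using h)
      (Bal.wrap bal_nil ())
  rw [hedgeFlat_injective (H := M) (K := [.node []]) (by simpa using hM)] at hg
  exact (Ctx.good_of_fill hg).1.1 rfl

end LDiamond

-- Finiteness and soundness of the base

namespace LDiamond

theorem Ty.length_pos (A : Ty) : 0 < A.length := by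
  induction A <;> simp [Ty.length] <;> omega

theorem finite_types {P : Set ℕ} (hP : P.Finite) (m : ℕ) :
    {A : Ty | InTp P A ∧ A.length ≤ m}.Finite := by
  induction m with
  | zero =>
    refine Set.finite_empty.subset fun A hA => ?_
    have := A.length_pos
    exact absurd hA.2 (by omega)
  | succ m ih =>
    -- Lengths are positive, so the immediate components of a type of length at most `m + 1` have
    -- length at most `m`.
    refine (((((hP.image Ty.prim).union (Set.Finite.image2 Ty.under ih ih)).union
      (Set.Finite.image2 Ty.over ih ih)).union (Set.Finite.image2 Ty.prod ih ih)).union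
      ((ih.image Ty.dia).union (ih.image Ty.box))).subset ?_
    rintro A ⟨hA, hl⟩
    cases hA with
    | prim h => exact .inl (.inl (.inl (.inl ⟨_, h, rfl⟩)))
    | @under A B hA hB =>
      have := A.length_pos
      have := B.length_pos
      rw [Ty.length] at hl
      exact .inl (.inl (.inl (.inr ⟨A, ⟨hA, by omega⟩, B, ⟨hB, by omega⟩, rfl⟩)))
    | prod hA hB =>
      rename_i A B
      have := A.length_pos
      have := B.length_pos
      rw [Ty.length] at hl
      exact .inl (.inr ⟨A, ⟨hA, by omega⟩, B, ⟨hB, by omega⟩, rfl⟩)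
    | dia hA =>
      rw [Ty.length] at hl
      exact .inr (.inl ⟨_, ⟨hA, by omega⟩, rfl⟩)
    | box hA =>
      rw [Ty.length] at hl
      exact .inr (.inr ⟨_, ⟨hA, by omega⟩, rfl⟩)
    | _ _ _ =>
      rename_i A B _ _
      have := A.length_pos
      have := B.length_pos
      rw [Ty.length] at hl
      exact .inl (.inl (.inr ⟨_, ⟨‹InTp P B›, by omega⟩, _, ⟨‹InTp P A›, by omega⟩, rfl⟩))

theorem cutBase_finite {P : Set ℕ} (hP : P.Finite) (m : ℕ) : (cutBase P m).Finite := by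
  have hT := finite_types hP m
  refine Set.Finite.union (Set.Finite.union ?_ ?_) ?_
  · refine ((hT.image fun C => (([] : Hedge) ⇒ C)).union
      ((Set.Finite.image2 (fun A C => ([Tree.leaf A] ⇒ C)) hT hT).union
      (Set.Finite.image2 (fun (q : Ty × Ty) C => ([Tree.leaf q.1, Tree.leaf q.2] ⇒ C))
        (hT.prod hT) hT))).subset ?_
    rintro s ⟨As, C, rfl, hl, hA, hC, hm, -⟩
    rcases As with - | ⟨A, - | ⟨B, - | ⟨D, As⟩⟩⟩
    · exact .inl ⟨C, ⟨hC, hm⟩, rfl⟩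
    · exact .inr (.inl ⟨A, hA A (by simp), C, ⟨hC, hm⟩, rfl⟩)
    · exact .inr (.inr ⟨(A, B), ⟨hA A (by simp), hA B (by simp)⟩, C, ⟨hC, hm⟩, rfl⟩)
    · simp at hl
  · refine (hT.image fun A => ([Tree.node [Tree.leaf A]] ⇒ .dia A)).subset ?_
    rintro s ⟨A, hA, hl, rfl⟩
    exact ⟨A, ⟨hA, by omega⟩, rfl⟩
  · refine (hT.image fun A => ([Tree.node [Tree.leaf (.box A)]] ⇒ A)).subset ?_
    rintro s ⟨A, hA, hl, rfl⟩
    exact ⟨A, ⟨hA, by omega⟩, rfl⟩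

theorem provable_id : (A : Ty) → Provable ([Tree.leaf A] ⇒ A)
  | .prim i => .init i
  | .under A B => .underR (by simp) (Provable.underL (Δ := .hole [] []) (Γ := [.leaf A])
      (provable_id A) (provable_id B))
  | .over B A => .overR (by simp) (Provable.overL (Δ := .hole [] []) (Γ := [.leaf A])
      (provable_id A) (provable_id B))
  | .prod A B => Provable.prodL (Γ := .hole [] [])
      (Provable.prodR (Γ := [.leaf A]) (provable_id A) (provable_id B))
  | .dia A => Provable.diaL (Γ := .hole [] []) (Provable.diaR (provable_id A))
  | .box A => .boxR (Provable.boxL (Γ := .hole [] []) (provable_id A))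

theorem CutDerivable.provable {P : Set ℕ} {m : ℕ} {s : Sequent}
    (h : CutDerivable (cutBase P m) s) : Provable s := by
  induction h with
  | mem h =>
    rcases h with (⟨As, C, rfl, -, -, -, -, h⟩ | ⟨A, -, -, rfl⟩) | ⟨A, -, -, rfl⟩
    · exact h
    · exact .diaR (provable_id A)
    · exact Provable.boxL (Γ := .hole [] []) (provable_id A)
  | cut _ _ h1 h2 => exact .cut h1 h2

-- Cut derivations on strings and short interpolants

/-- Every hedge represented by `X` derives `C` by Cut from the base. -/
def CutProv (P : Set ℕ) (m : ℕ) (X : Str) (C : DTy) : Prop :=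
  ∀ H, hedgeFlat H = X.map Tok.erase → CutDerivable (cutBase P m) (H ⇒ C.erase)

/-- The decorated type comes from a type in `Tp(P)` of length at most `m`. -/
def Short (P : Set ℕ) (m : ℕ) (A : DTy) : Prop := InTp P A.erase ∧ A.length ≤ m

/-- All leaves of the string are short. -/
def ShortL (P : Set ℕ) (m : ℕ) (X : Str) : Prop := ∀ A, .leaf A ∈ X → Short P m A

theorem DTy.length_erase (A : DTy) : A.erase.length = A.length := by
  induction A <;> simp [erase, length, Ty.length, *]

theorem DTy.forall_cnt_add {P : Set ℕ} (A B : DTy) : ((∀ p k, A.cnt (.pr p k) ≠ 0 → p ∈ P) ∧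
    ∀ p k, B.cnt (.pr p k) ≠ 0 → p ∈ P) ↔
    ∀ p k, A.cnt (.pr p k) + B.cnt (.pr p k) ≠ 0 → p ∈ P := by
  refine ⟨fun h p k hn => ?_, fun h => ⟨fun p k hn => h p k (by omega),
    fun p k hn => h p k (by omega)⟩⟩
  by_cases h' : A.cnt (.pr p k) = 0
  · exact h.2 p k (by omega)
  · exact h.1 p k h'

/-- With membership expressed by letter counts, the count bounds of an interpolant keep it inside
`Tp(P)`. -/
theorem DTy.inTp_erase_iff {P : Set ℕ} {A : DTy} :
    InTp P A.erase ↔ ∀ p k, A.cnt (.pr p k) ≠ 0 → p ∈ P := by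
  induction A with
  | prim p k =>
    constructor
    · rintro ⟨h⟩ q l hq
      simp only [cnt, Letter.ind, ne_eq, ite_eq_right_iff, Letter.pr.injEq, one_ne_zero, imp_false,
        not_not] at hq
      exact hq.1 ▸ h
    · intro h
      exact .prim (h p k (by simp [cnt, Letter.ind]))
  | ldiv A B hA hB =>
    have e : InTp P (ldiv A B).erase ↔ InTp P A.erase ∧ InTp P B.erase :=
      ⟨fun h => by cases h; exact ⟨‹_›, ‹_›⟩, fun h => .under h.1 h.2⟩
    rw [e, hA, hB]
    exact forall_cnt_add A B
  | rdiv B A hB hA =>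
    have e : InTp P (rdiv B A).erase ↔ InTp P A.erase ∧ InTp P B.erase :=
      ⟨fun h => by cases h; exact ⟨‹_›, ‹_›⟩, fun h => .over h.2 h.1⟩
    rw [e, hA, hB]
    simpa only [cnt, Nat.add_comm] using forall_cnt_add (P := P) A B
  | prod A B hA hB =>
    have e : InTp P (prod A B).erase ↔ InTp P A.erase ∧ InTp P B.erase :=
      ⟨fun h => by cases h; exact ⟨‹_›, ‹_›⟩, fun h => .prod h.1 h.2⟩
    rw [e, hA, hB]
    exact forall_cnt_add A B
  | dia i A hA =>
    have e : InTp P (dia i A).erase ↔ InTp P A.erase :=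
      ⟨fun h => by cases h; assumption, fun h => .dia h⟩
    rw [e, hA]
    simp [cnt, Letter.ind]
  | box i A hA =>
    have e : InTp P (box i A).erase ↔ InTp P A.erase :=
      ⟨fun h => by cases h; assumption, fun h => .box h⟩
    rw [e, hA]
    simp [cnt, Letter.ind]

section Main

variable {P : Set ℕ} {m : ℕ}

theorem ShortL.append {X Y : Str} : ShortL P m (X ++ Y) ↔ ShortL P m X ∧ ShortL P m Y := by
  simp only [ShortL, List.mem_append]
  exact ⟨fun h => ⟨fun A hA => h A (.inl hA), fun A hA => h A (.inr hA)⟩,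
    fun h A hA => hA.elim (h.1 A) (h.2 A)⟩

@[simp] theorem ShortL.nil : ShortL P m [] := fun A hA => by simp at hA

@[simp] theorem ShortL.leaf_cons {X : Str} {A : DTy} :
    ShortL P m (.leaf A :: X) ↔ Short P m A ∧ ShortL P m X := by
  simp [ShortL]

@[simp] theorem ShortL.op_cons {X : Str} {i : ℕ} : ShortL P m (.op i :: X) ↔ ShortL P m X := by
  simp [ShortL]

@[simp] theorem ShortL.cl_cons {X : Str} {i : ℕ} : ShortL P m (.cl i :: X) ↔ ShortL P m X := by
  simp [ShortL]

theorem ShortL.mem {X : Str} (h : ShortL P m X) {p k : ℕ} (hX : cntL (.pr p k) X ≠ 0) : p ∈ P := by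
  induction X with
  | nil => simp at hX
  | cons a X ih =>
    cases a with
    | leaf A =>
      rw [leaf_cons] at h
      by_cases h0 : A.cnt (.pr p k) = 0
      · exact ih h.2 (by simpa [Tok.cnt, h0] using hX)
      · exact DTy.inTp_erase_iff.1 h.1.1 p k h0
    | op i => exact ih (op_cons.1 h) (by simpa [Tok.cnt, Letter.ind] using hX)
    | cl i => exact ih (cl_cons.1 h) (by simpa [Tok.cnt, Letter.ind] using hX)

theorem ShortL.inTp {X : Str} (h : ShortL P m X) {E : DTy} (hE : ∀ x, E.cnt x ≤ cntL x X) :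
    InTp P E.erase :=
  DTy.inTp_erase_iff.2 fun p k hn => h.mem (p := p) (k := k) (by have := hE (.pr p k); omega)

theorem CutProv.cut {L X R : Str} {A C : DTy} (h1 : CutProv P m X A)
    (h2 : CutProv P m (L ++ .leaf A :: R) C) (hX : Bal X) : CutProv P m (L ++ (X ++ R)) C := by
  intro H h
  simp only [List.map_append] at h
  obtain ⟨c, M, rfl, hM, hc⟩ := exists_fill_eq h hX.erase
  exact .cut (h1 M hM) (h2 _ (by rw [hc]; simp [Tok.erase]))

theorem cutProv_of_length_le {As : List DTy} {C : DTy} (hl : As.length ≤ 2)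
    (d : DP (As.map Tok.leaf) C) (hA : ShortL P m (As.map Tok.leaf)) (hC : Short P m C) :
    CutProv P m (As.map Tok.leaf) C := by
  intro H h
  have hf : ∀ Bs : List DTy, hedgeFlat ((Bs.map DTy.erase).map Tree.leaf) =
      (Bs.map Tok.leaf).map Tok.erase := by
    intro Bs
    induction Bs with
    | nil => simp
    | cons B Bs ih => simpa [Tok.erase] using ih
  refine .mem (.inl (.inl ⟨As.map DTy.erase, C.erase, ?_, by simpa using hl, ?_, hC.1,
    by rw [DTy.length_erase]; exact hC.2, d.provable H h⟩))
  · rw [hedgeFlat_injective (h.trans (hf As).symm)]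
  · intro A hA'
    obtain ⟨B, hB, rfl⟩ := List.mem_map.1 hA'
    have := hA B (List.mem_map_of_mem hB)
    exact ⟨this.1, by rw [DTy.length_erase]; exact this.2⟩

theorem cutProv_dia {A : DTy} {i : ℕ} (hA : InTp P A.erase) (hm : A.length + 2 ≤ m) :
    CutProv P m [.op i, .leaf A, .cl i] (.dia i A) := by
  intro H h
  rw [hedgeFlat_injective (H := H) (K := [.node [.leaf A.erase]]) (by simpa [Tok.erase] using h)]
  exact .mem (.inl (.inr ⟨A.erase, hA, by rwa [DTy.length_erase], rfl⟩))

theorem cutProv_box {A : DTy} {i : ℕ} (hA : InTp P A.erase) (hm : A.length + 2 ≤ m) :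
    CutProv P m [.op i, .leaf (.box i A), .cl i] A := by
  intro H h
  rw [hedgeFlat_injective (H := H) (K := [.node [.leaf (.box A.erase)]])
    (by simpa [Tok.erase, DTy.erase] using h)]
  exact .mem (.inr ⟨A.erase, hA, by rwa [DTy.length_erase], rfl⟩)

end Main

/-- Derivability of a thin sequent. -/
def ThinDP (X : Str) (C : DTy) : Prop := DP X C ∧ Thin X C

/-- Interpolants for thin sequents have the length of their value in the free group. -/
theorem ThinDP.interpolate {L D R : Str} {C : DTy} (d : ThinDP (L ++ (D ++ R)) C) (hb : Bal D)
    (hn : D ≠ []) : ∃ E, ThinDP D E ∧ ThinDP (L ++ .leaf E :: R) C ∧ E.val = valL D ∧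
      E.length = (valL D).norm ∧ (∀ x, E.cnt x ≤ cntL x D) ∧
      ∀ x, E.cnt x ≤ cntL x L + cntL x R + C.cnt x := by
  obtain ⟨E, h1, h2, h3, h4⟩ := d.1.hasInterp L D R rfl hb hn
  -- The counts inside and outside of `D` add up to at most 2. As `E` is bounded by each, it may
  -- replace either side without losing thinness.
  have ht : ∀ x, cntL x L + cntL x D + cntL x R + C.cnt x ≤ 2 := fun x => by
    have := d.2 x
    simp at this
    omega
  refine ⟨E, ⟨h1, fun x => ?_⟩, ⟨h2, fun x => ?_⟩, h1.valL_eq.symm, ?_, h3, h4⟩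
  · have := ht x
    have := h4 x
    omega
  · have := ht x
    have := h3 x
    simp [Tok.cnt]
    omega
  -- The smaller of two numbers with sum at most 2 is at most 1.
  · rw [h1.valL_eq, DTy.norm_val_eq]
    intro x
    have := ht x
    have := h3 x
    have := h4 x
    omega

/-- The interpolant of the leaf alone has positive length, and this length is the norm of the leaf.
-/
theorem ThinDP.one_le_norm_leaf {L R : Str} {A C : DTy} (d : ThinDP (L ++ .leaf A :: R) C) :
    1 ≤ A.val.norm := by
  obtain ⟨E, -, -, -, h, -⟩ := ThinDP.interpolate (D := [.leaf A]) d (by simp) (by simp)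
  have := E.length_pos
  simp [Tok.val] at h
  omega

theorem ThinDP.one_le_norm {X : Str} {C : DTy} (d : ThinDP X C) : 1 ≤ C.val.norm := by
  obtain ⟨E, -, -, -, h, -⟩ := ThinDP.interpolate (L := []) (R := []) (D := X) (C := C)
    (by simpa using d) d.1.bal d.1.ne_nil
  have := E.length_pos
  rw [d.1.valL_eq] at h
  omega

/-- A possibly empty segment is replaced by an interpolant or stays empty. -/
theorem ThinDP.interpolate_segment {P : Set ℕ} {m : ℕ} {L D R : Str} {C : DTy}
    (d : ThinDP (L ++ (D ++ R)) C) (hb : Bal D) (hD : ShortL P m D)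
    (ih : ∀ E, ThinDP D E → Short P m E → CutProv P m D E) (hm : (valL D).norm ≤ m) :
    ∃ Φ, Bal Φ ∧ Φ.length ≤ D.length ∧ ThinDP (L ++ (Φ ++ R)) C ∧ ShortL P m Φ ∧
      ∀ L' R' B, CutProv P m (L' ++ (Φ ++ R')) B → CutProv P m (L' ++ (D ++ R')) B := by
  by_cases hn : D = []
  · subst hn
    exact ⟨[], by simp, le_rfl, d, by simp, fun _ _ _ h => h⟩
  obtain ⟨E, h1, h2, -, h4, h5, -⟩ := d.interpolate hb hn
  have hE : Short P m E := ⟨hD.inTp h5, h4.trans_le hm⟩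
  exact ⟨[.leaf E], by simp, List.length_pos_iff.2 hn, h2, by simpa using hE,
    fun _ _ _ h => (ih E h1 hE).cut h hb⟩

end LDiamond

-- A bracket linked to a neighbouring type

namespace LDiamond

open FreeGroup

theorem avoids_valL {x : Letter} {X : Str} (h : cntL x X = 0) : Avoids x (valL X) := by
  induction X with
  | nil => exact avoids_one x
  | cons a X ih =>
    rw [cntL_cons] at h
    rw [valL_cons]
    refine Avoids.mul ?_ (ih (by omega))
    have ha : a.cnt x = 0 := by omega
    have ind : ∀ y : Letter, x.ind y = 0 → y ≠ x := by
      rintro y hy rfl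
      simp [Letter.ind] at hy
    cases a with
    | leaf A => exact DTy.avoids ha
    | op i => exact avoids_of (ind _ ha)
    | cl i => exact avoids_of (ind _ ha)

section Main

variable {P : Set ℕ} {m : ℕ}

/-- The induction hypothesis of the main argument. -/
def CutProvBelow (P : Set ℕ) (m : ℕ) (Y : Str) : Prop :=
  ∀ X C, X.length < Y.length → ThinDP X C → ShortL P m X → Short P m C → CutProv P m X C

/-- A leaf is linked to the bracket that directly encloses it. -/
theorem cutProv_of_link_inside {L Δ₁ Δ₂ R : Str} {i : ℕ} {A C : DTy}
    (d : ThinDP (L ++ (.op i :: (Δ₁ ++ .leaf A :: (Δ₂ ++ [.cl i])) ++ R)) C)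
    (hs : ShortL P m (L ++ (.op i :: (Δ₁ ++ .leaf A :: (Δ₂ ++ [.cl i])) ++ R)))
    (hC : Short P m C)
    (ih : CutProvBelow P m (L ++ (.op i :: (Δ₁ ++ .leaf A :: (Δ₂ ++ [.cl i])) ++ R)))
    (b1 : Bal Δ₁) (b2 : Bal Δ₂) (hA : A.cnt (.op i) ≠ 0) :
    CutProv P m (L ++ (.op i :: (Δ₁ ++ .leaf A :: (Δ₂ ++ [.cl i])) ++ R)) C := by
  have hbW : Bal (.op i :: (Δ₁ ++ .leaf A :: (Δ₂ ++ [.cl i]))) := by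
    have := Bal.wrap (b1.append (Y := .leaf A :: Δ₂) b2) i
    simpa using this
  obtain ⟨E, dE, dC, hv, hl, c1, c2⟩ := d.interpolate hbW (by simp)
  have hAc := A.cnt_op_eq_cnt_cl i
  -- The bracket and `A` use up both occurrences allowed. Nothing is left outside of the segment, so
  -- `E` avoids the letter as well.
  have hop : cntL (.op i) Δ₁ = 0 ∧ cntL (.op i) Δ₂ = 0 ∧ E.cnt (.op i) = 0 := by
    have h1 := d.2 (.op i)
    have h2 := c2 (.op i)
    simp [Tok.cnt, Letter.ind] at h1
    omega
  have hcl : cntL (.cl i) Δ₁ = 0 ∧ cntL (.cl i) Δ₂ = 0 ∧ E.cnt (.cl i) = 0 := by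
    have h1 := d.2 (.cl i)
    have h2 := c2 (.cl i)
    simp [Tok.cnt, Letter.ind] at h1
    omega
  rw [ShortL.append, ShortL.append] at hs
  obtain ⟨sL, sW, sR⟩ := hs
  have hET := sW.inTp c1
  rw [ShortL.op_cons, ShortL.append, ShortL.leaf_cons, ShortL.append] at sW
  obtain ⟨s1, sA, s2, -⟩ := sW
  -- Solved for `A`, the equation of the segment is a product separated by bracket generators that
  -- occur nowhere else. Nothing cancels, so `‖E‖ + 2` and the norms of `Δ₁`, `Δ₂` are bounded by
  -- the length of `A`.
  have hnorm : A.val.norm = (valL Δ₁).norm + 1 + (E.length + 1 + (valL Δ₂).norm) := by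
    have e : A.val = (valL Δ₁)⁻¹ * (of (.op i))⁻¹ *
        (E.val * (of (.cl i))⁻¹ * (valL Δ₂)⁻¹) := by
      rw [hv]
      simp [Tok.val]
      group
    have ae := DTy.avoids hop.2.2
    have ae' := DTy.avoids hcl.2.2
    have a2 : Avoids (.op i) (of (Letter.cl i))⁻¹ := (avoids_of (by simp)).inv
    rw [e, norm_mul_inv_of_mul (avoids_valL hop.1).inv
        ((ae.mul a2).mul (avoids_valL hop.2.1).inv),
      norm_mul_inv_of_mul ae' (avoids_valL hcl.2.1).inv, norm_inv_eq, norm_inv_eq, hl, hv]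
  have hAm : A.val.norm ≤ m := A.norm_val_le.trans sA.2
  obtain ⟨Φ₁, bΦ₁, l1, d1, t1, cut1⟩ := ThinDP.interpolate_segment (L := [.op i])
    (D := Δ₁) (R := .leaf A :: (Δ₂ ++ [Tok.cl i])) (P := P) (m := m) dE b1 s1
    (fun F hF hF' => ih _ _ (by simp; omega) hF s1 hF') (by omega)
  obtain ⟨Φ₂, bΦ₂, l2, d2, t2, cut2⟩ := ThinDP.interpolate_segment
    (L := .op i :: (Φ₁ ++ [.leaf A])) (D := Δ₂) (R := [.cl i]) (P := P) (m := m)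
    (by simpa using d1) b2 s2
    (fun F hF hF' => ih _ _ (by simp; omega) hF s2 hF') (by omega)
  -- The enclosing bracket moves to the succedent as `□↓`. This shortens the string, and the base
  -- sequent `⟨□↓E⟩ ⇒ E` restores the bracket.
  have dB : ThinDP (Φ₁ ++ .leaf A :: Φ₂) (.box i E) := by
    refine ⟨.boxR (bΦ₁.append bΦ₂) (by simp) (by simpa using d2.1), fun x => ?_⟩
    have := d2.2 x
    simp [Tok.cnt, DTy.cnt] at this ⊢
    omega
  have sB : Short P m (.box i E) := ⟨.box hET, by rw [DTy.length]; omega⟩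
  have kB := ih _ _ (by simp; omega) dB
    (by rw [ShortL.append, ShortL.leaf_cons]; exact ⟨t1, sA, t2⟩) sB
  have kB' : CutProv P m (Δ₁ ++ .leaf A :: Δ₂) (.box i E) := by
    have := cut2 (Φ₁ ++ [.leaf A]) [] _ (by simpa using kB)
    have := cut1 [] (.leaf A :: Δ₂) _ (by simpa using this)
    simpa using this
  have kW : CutProv P m (.op i :: (Δ₁ ++ .leaf A :: (Δ₂ ++ [.cl i]))) E := by
    have := kB'.cut (L := [.op i]) (R := [.cl i])
      (cutProv_box hET (by omega)) (b1.append (Y := .leaf A :: Δ₂) b2)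
    simpa using this
  exact kW.cut (ih _ _ (by simp; omega) dC
    (by rw [ShortL.append, ShortL.leaf_cons]; exact ⟨sL, ⟨hET, by omega⟩, sR⟩) hC) hbW

/-- A leaf is linked to the bracket on its left. -/
theorem cutProv_of_link_left {L Δ R : Str} {i : ℕ} {A C : DTy}
    (d : ThinDP (L ++ (.op i :: (Δ ++ [.cl i, .leaf A]) ++ R)) C)
    (hs : ShortL P m (L ++ (.op i :: (Δ ++ [.cl i, .leaf A]) ++ R))) (hC : Short P m C)
    (ih : CutProvBelow P m (L ++ (.op i :: (Δ ++ [.cl i, .leaf A]) ++ R)))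
    (b : Bal Δ) (hn : Δ ≠ []) (hA : A.cnt (.op i) ≠ 0) :
    CutProv P m (L ++ (.op i :: (Δ ++ [.cl i, .leaf A]) ++ R)) C := by
  have hbW : Bal (.op i :: (Δ ++ [.cl i, .leaf A])) := by
    have := (b.wrap i).append (Y := [.leaf A]) (by simp)
    simpa using this
  obtain ⟨E, dE, dC, hv, hl, c1, c2⟩ := d.interpolate hbW (by simp)
  have hAc := A.cnt_op_eq_cnt_cl i
  have hop : cntL (.op i) Δ = 0 ∧ E.cnt (.op i) = 0 := by
    have h1 := d.2 (.op i)
    have h2 := c2 (.op i)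
    simp [Tok.cnt, Letter.ind] at h1
    omega
  have hcl : cntL (.cl i) Δ = 0 ∧ E.cnt (.cl i) = 0 := by
    have h1 := d.2 (.cl i)
    have h2 := c2 (.cl i)
    simp [Tok.cnt, Letter.ind] at h1
    omega
  rw [ShortL.append, ShortL.append] at hs
  obtain ⟨sL, sW, sR⟩ := hs
  have hET := sW.inTp c1
  rw [ShortL.op_cons, ShortL.append, ShortL.cl_cons, ShortL.leaf_cons] at sW
  obtain ⟨sΔ, sA, -⟩ := sW
  -- `A` pays for the pair of brackets, for `Δ` and for `E` at once, so `◇F`, with `F` an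
  -- interpolant of `Δ`, is short too.
  have hnorm : A.val.norm = 1 + ((valL Δ).norm + 1 + E.length) := by
    have e : A.val = 1 * (of (.cl i))⁻¹ * ((valL Δ)⁻¹ * (of (.op i))⁻¹ * E.val) := by
      rw [hv]
      simp [Tok.val]
    have a2 : Avoids (.cl i) (of (Letter.op i))⁻¹ := (avoids_of (by simp)).inv
    rw [e, norm_mul_inv_of_mul (avoids_one _)
        (((avoids_valL hcl.1).inv.mul a2).mul (DTy.avoids hcl.2)),
      norm_mul_inv_of_mul (avoids_valL hop.1).inv (DTy.avoids hop.2), norm_inv_eq, hl, hv,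
      FreeGroup.norm_one]
  have hAm : A.val.norm ≤ m := A.norm_val_le.trans sA.2
  obtain ⟨F, dF, dE', -, lF, k1, -⟩ := ThinDP.interpolate (L := [.op i]) (D := Δ)
    (R := [.cl i, .leaf A]) dE b hn
  have sF : Short P m F := ⟨sΔ.inTp k1, by omega⟩
  have sD : Short P m (.dia i F) := ⟨.dia sF.1, by rw [DTy.length]; omega⟩
  have sE : Short P m E := ⟨hET, by omega⟩
  have kΔ := ih _ _ (by simp; omega) dF sΔ sF
  -- Once `⟨Δ⟩` has become `◇F`, what remains is a base sequent with two antecedent types.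
  have kE := cutProv_of_length_le (As := [.dia i F, A]) (by simp)
    (DP.diaL (L := []) dE'.1) (by simp [sD, sA]) sE
  have kW : CutProv P m (.op i :: (Δ ++ [.cl i, .leaf A])) E := by
    have h1 := (cutProv_dia (i := i) sF.1 (by omega)).cut (L := []) (R := [.leaf A]) kE
      (Bal.wrap (X := [.leaf F]) (by simp) i)
    have := kΔ.cut (L := [.op i]) (R := [.cl i, .leaf A]) h1 b
    simpa using this
  exact kW.cut (ih _ _ (by simp; omega) dC
    (by rw [ShortL.append, ShortL.leaf_cons]; exact ⟨sL, sE, sR⟩) hC) hbW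

/-- A leaf is linked to the bracket on its right. -/
theorem cutProv_of_link_right {L Δ R : Str} {i : ℕ} {A C : DTy}
    (d : ThinDP (L ++ (.leaf A :: .op i :: (Δ ++ [.cl i]) ++ R)) C)
    (hs : ShortL P m (L ++ (.leaf A :: .op i :: (Δ ++ [.cl i]) ++ R))) (hC : Short P m C)
    (ih : CutProvBelow P m (L ++ (.leaf A :: .op i :: (Δ ++ [.cl i]) ++ R)))
    (b : Bal Δ) (hn : Δ ≠ []) (hA : A.cnt (.op i) ≠ 0) :
    CutProv P m (L ++ (.leaf A :: .op i :: (Δ ++ [.cl i]) ++ R)) C := by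
  have hbW : Bal (.leaf A :: .op i :: (Δ ++ [.cl i])) := b.wrap i
  obtain ⟨E, dE, dC, hv, hl, c1, c2⟩ := d.interpolate hbW (by simp)
  have hAc := A.cnt_op_eq_cnt_cl i
  have hop : cntL (.op i) Δ = 0 ∧ E.cnt (.op i) = 0 := by
    have h1 := d.2 (.op i)
    have h2 := c2 (.op i)
    simp [Tok.cnt, Letter.ind] at h1
    omega
  have hcl : cntL (.cl i) Δ = 0 ∧ E.cnt (.cl i) = 0 := by
    have h1 := d.2 (.cl i)
    have h2 := c2 (.cl i)
    simp [Tok.cnt, Letter.ind] at h1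
    omega
  rw [ShortL.append, ShortL.append] at hs
  obtain ⟨sL, sW, sR⟩ := hs
  have hET := sW.inTp c1
  rw [ShortL.leaf_cons, ShortL.op_cons, ShortL.append] at sW
  obtain ⟨sA, sΔ, -⟩ := sW
  have hnorm : A.val.norm = E.length + 1 + ((valL Δ).norm + 1) := by
    have e : A.val = E.val * (of (.cl i))⁻¹ * ((valL Δ)⁻¹ * (of (.op i))⁻¹ * 1) := by
      rw [hv]
      simp [Tok.val]
      group
    have a2 : Avoids (.cl i) (of (Letter.op i))⁻¹ := (avoids_of (by simp)).inv
    rw [e, norm_mul_inv_of_mul (DTy.avoids hcl.2)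
        (((avoids_valL hcl.1).inv.mul a2).mul (avoids_one _)),
      norm_mul_inv_of_mul (avoids_valL hop.1).inv (avoids_one _), norm_inv_eq, hl, hv,
      FreeGroup.norm_one]
  have hAm : A.val.norm ≤ m := A.norm_val_le.trans sA.2
  obtain ⟨F, dF, dE', -, lF, k1, -⟩ := ThinDP.interpolate (L := [.leaf A, .op i]) (D := Δ)
    (R := [.cl i]) dE b hn
  have sF : Short P m F := ⟨sΔ.inTp k1, by omega⟩
  have sD : Short P m (.dia i F) := ⟨.dia sF.1, by rw [DTy.length]; omega⟩
  have sE : Short P m E := ⟨hET, by omega⟩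
  have kΔ := ih _ _ (by simp; omega) dF sΔ sF
  have kE := cutProv_of_length_le (As := [A, .dia i F]) (by simp)
    (DP.diaL (L := [.leaf A]) dE'.1) (by simp [sD, sA]) sE
  have kW : CutProv P m (.leaf A :: .op i :: (Δ ++ [.cl i])) E := by
    have h1 := (cutProv_dia (i := i) sF.1 (by omega)).cut (L := [.leaf A]) (R := []) kE
      (Bal.wrap (X := [.leaf F]) (by simp) i)
    exact kΔ.cut (L := [.leaf A, .op i]) (R := [.cl i]) h1 b
  exact kW.cut (ih _ _ (by simp; omega) dC
    (by rw [ShortL.append, ShortL.leaf_cons]; exact ⟨sL, sE, sR⟩) hC) hbW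

/-- The succedent is linked to the last bracket. -/
theorem cutProv_of_link_succedent {L Δ : Str} {i : ℕ} {C : DTy}
    (d : ThinDP (L ++ .op i :: (Δ ++ [.cl i])) C)
    (hs : ShortL P m (L ++ .op i :: (Δ ++ [.cl i]))) (hC : Short P m C)
    (ih : CutProvBelow P m (L ++ .op i :: (Δ ++ [.cl i])))
    (b : Bal Δ) (hn : Δ ≠ []) (hA : C.cnt (.op i) ≠ 0) :
    CutProv P m (L ++ .op i :: (Δ ++ [.cl i])) C := by
  have bL : Bal L := Bal.left (b.wrap i) d.1.bal
  have hCc := C.cnt_op_eq_cnt_cl i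
  have hop : cntL (.op i) L = 0 ∧ cntL (.op i) Δ = 0 := by
    have h1 := d.2 (.op i)
    simp [Tok.cnt, Letter.ind] at h1
    omega
  have hcl : cntL (.cl i) L = 0 ∧ cntL (.cl i) Δ = 0 := by
    have h1 := d.2 (.cl i)
    simp [Tok.cnt, Letter.ind] at h1
    omega
  rw [ShortL.append, ShortL.op_cons, ShortL.append] at hs
  obtain ⟨sL, sΔ, -⟩ := hs
  -- Here the succedent pays: it is the product of `L`, the brackets and `Δ`, without cancellation.
  have hnorm : C.val.norm = (valL L).norm + 1 + ((valL Δ).norm + 1) := by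
    have e : C.val = valL L * of (.op i) * (valL Δ * of (.cl i) * 1) := by
      rw [← d.1.valL_eq]
      simp [Tok.val, mul_assoc]
    have a2 : Avoids (.op i) (of (Letter.cl i)) := avoids_of (by simp)
    rw [e, norm_mul_of_mul (avoids_valL hop.1) (((avoids_valL hop.2).mul a2).mul (avoids_one _)),
      norm_mul_of_mul (avoids_valL hcl.2) (avoids_one _), FreeGroup.norm_one]
  have hCm : C.val.norm ≤ m := C.norm_val_le.trans hC.2
  obtain ⟨Φ, bΦ, l1, d1, t1, cut1⟩ := ThinDP.interpolate_segment (L := [])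
    (D := L) (R := .op i :: (Δ ++ [Tok.cl i])) (P := P) (m := m) d bL sL
    (fun F hF hF' => ih _ _ (by simp) hF sL hF') (by omega)
  obtain ⟨F, dF, d2, -, lF, k2, -⟩ := ThinDP.interpolate (L := Φ ++ [.op i]) (D := Δ)
    (R := [.cl i]) (by simpa using d1) b hn
  have sF : Short P m F := ⟨sΔ.inTp k2, by omega⟩
  have sD : Short P m (.dia i F) := ⟨.dia sF.1, by rw [DTy.length]; omega⟩
  have dD : ThinDP (Φ ++ [.leaf (.dia i F)]) C := by
    refine ⟨.diaL (by simpa using d2.1), fun x => ?_⟩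
    have := d2.2 x
    simp [Tok.cnt, DTy.cnt] at this ⊢
    omega
  have kΔ := ih _ _ (by simp; omega) dF sΔ sF
  have kD := ih _ _ (by simp; omega) dD
    (by rw [ShortL.append, ShortL.leaf_cons]; exact ⟨t1, sD, by simp⟩) hC
  have h1 := (cutProv_dia (i := i) sF.1 (by omega)).cut (R := []) kD
      (Bal.wrap (X := [.leaf F]) (by simp) i)
  have h2 := cut1 [] _ _ h1
  have := kΔ.cut (L := L ++ [.op i]) (R := [.cl i]) (by simpa using h2) b
  simpa using this

end Main

end LDiamond

-- The main induction

namespace LDiamond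

open FreeGroup

section Main

variable {P : Set ℕ} {m : ℕ}

/-- If the generator did not occur in `A`, it could not cancel, and the product would have norm `1 +
‖A‖`, with `‖A‖` the norm of the value. As that norm is positive, this exceeds the maximum. The
companions below argue alike for the other bracket, the other side and the succedent. -/
theorem cnt_op_ne_zero_of_norm_op_mul {A : DTy} {i : ℕ} (hA : 1 ≤ A.val.norm)
    (h : (of (Letter.op i) * A.val).norm ≤ max (of (Letter.op i)).norm A.val.norm) :
    A.cnt (.op i) ≠ 0 := fun h0 => by
  have := norm_mul_of_mul (avoids_one (Letter.op i)) (DTy.avoids h0)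
  rw [one_mul, FreeGroup.norm_one] at this
  rw [norm_of] at h
  omega

theorem cnt_cl_ne_zero_of_norm_cl_mul {A : DTy} {i : ℕ} (hA : 1 ≤ A.val.norm)
    (h : (of (Letter.cl i) * A.val).norm ≤ max (of (Letter.cl i)).norm A.val.norm) :
    A.cnt (.op i) ≠ 0 := fun h0 => by
  rw [DTy.cnt_op_eq_cnt_cl] at h0
  have := norm_mul_of_mul (avoids_one (Letter.cl i)) (DTy.avoids h0)
  rw [one_mul, FreeGroup.norm_one] at this
  rw [norm_of] at h
  omega

theorem cnt_op_ne_zero_of_norm_mul_op {A : DTy} {i : ℕ} (hA : 1 ≤ A.val.norm)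
    (h : (A.val * of (Letter.op i)).norm ≤ max A.val.norm (of (Letter.op i)).norm) :
    A.cnt (.op i) ≠ 0 := fun h0 => by
  have := norm_mul_of_mul (DTy.avoids h0) (avoids_one (Letter.op i))
  rw [mul_one, FreeGroup.norm_one] at this
  rw [norm_of] at h
  omega

theorem cnt_cl_ne_zero_of_norm_mul_cl {A : DTy} {i : ℕ} (hA : 1 ≤ A.val.norm)
    (h : (A.val * of (Letter.cl i)).norm ≤ max A.val.norm (of (Letter.cl i)).norm) :
    A.cnt (.op i) ≠ 0 := fun h0 => by
  rw [DTy.cnt_op_eq_cnt_cl] at h0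
  have := norm_mul_of_mul (DTy.avoids h0) (avoids_one (Letter.cl i))
  rw [mul_one, FreeGroup.norm_one] at this
  rw [norm_of] at h
  omega

theorem cnt_cl_ne_zero_of_norm_cl_mul_inv {C : DTy} {i : ℕ} (hC : 1 ≤ C.val.norm)
    (h : (of (Letter.cl i) * C.val⁻¹).norm ≤ max (of (Letter.cl i)).norm C.val⁻¹.norm) :
    C.cnt (.op i) ≠ 0 := fun h0 => by
  rw [DTy.cnt_op_eq_cnt_cl] at h0
  have := norm_mul_of_mul (avoids_one (Letter.cl i)) (DTy.avoids h0).inv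
  rw [one_mul, FreeGroup.norm_one, norm_inv_eq] at this
  rw [norm_of, norm_inv_eq] at h
  omega

theorem not_norm_of_mul_of_le (x y : Letter) :
    ¬ (of x * of y).norm ≤ max (of x).norm (of y).norm := by
  rw [norm_of_mul_of, norm_of, norm_of]
  omega

/-- Two adjacent leaves are replaced by an interpolant. -/
theorem cutProv_of_adjacent_leaves {L R : Str} {A B C : DTy}
    (d : ThinDP (L ++ .leaf A :: .leaf B :: R) C) (hs : ShortL P m (L ++ .leaf A :: .leaf B :: R))
    (hC : Short P m C) (ih : CutProvBelow P m (L ++ .leaf A :: .leaf B :: R))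
    (hn : (A.val * B.val).norm ≤ m) : CutProv P m (L ++ .leaf A :: .leaf B :: R) C := by
  obtain ⟨E, dE, dC, -, hl, c1, -⟩ := ThinDP.interpolate (D := [.leaf A, .leaf B]) d
    (by simp) (by simp)
  simp only [ShortL.append, ShortL.leaf_cons] at hs
  obtain ⟨sL, sA, sB, sR⟩ := hs
  have sE : Short P m E := by
    refine ⟨ShortL.inTp (P := P) (m := m) (by simp [sA, sB]) c1, ?_⟩
    simp [Tok.val] at hl
    omega
  exact (cutProv_of_length_le (As := [A, B]) (by simp) dE.1 (by simp [sA, sB]) sE).cut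
    (ih _ _ (by simp) dC (by simp [ShortL.append, sL, sE, sR]) hC) (by simp)

/-- Everything before the last leaf is replaced by an interpolant. -/
theorem cutProv_of_last_leaf {L : Str} {A C : DTy} (d : ThinDP (L ++ [.leaf A]) C)
    (hs : ShortL P m (L ++ [.leaf A])) (hC : Short P m C)
    (ih : CutProvBelow P m (L ++ [.leaf A])) (hn : (A.val * C.val⁻¹).norm ≤ m) :
    CutProv P m (L ++ [.leaf A]) C := by
  simp only [ShortL.append, ShortL.leaf_cons] at hs
  obtain ⟨sL, sA, -⟩ := hs
  by_cases h0 : L = []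
  · subst h0
    exact cutProv_of_length_le (As := [A]) (by simp) d.1 (by simp [sA]) hC
  have bL : Bal L := Bal.left (Y := [.leaf A]) (by simp) d.1.bal
  obtain ⟨E, dE, dC, -, hl, c1, -⟩ := ThinDP.interpolate (L := []) d bL h0
  -- The equation of the sequent expresses `L` through its last leaf and the succedent, and
  -- inversion preserves norms.
  have e : valL L = (A.val * C.val⁻¹)⁻¹ := by
    rw [← d.1.valL_eq]
    simp [Tok.val]
  have sE : Short P m E := ⟨sL.inTp c1, by rw [hl, e, norm_inv_eq]; exact hn⟩
  exact (ih _ _ (by simp) dE sL sE).cut (L := [])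
    (cutProv_of_length_le (As := [E, A]) (by simp) dC.1 (by simp [sE, sA]) hC) bL

/-- Thin derivable sequents with short types are derivable by Cut from the base. -/
theorem ThinDP.cutProv {X : Str} {C : DTy} (d : ThinDP X C) (hs : ShortL P m X)
    (hC : Short P m C) : CutProv P m X C := by
  induction hk : X.length using Nat.strong_induction_on generalizing X C with
  | _ k ih =>
  have ih : CutProvBelow P m X := fun Y D hY dY sY sD => ih _ (hk ▸ hY) dY sY sD rfl
  clear hk
  -- The inverse of the succedent closes the equation of the sequent to a product equal to 1, which
  -- has at least two factors because `X` is nonempty.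
  have hprod : (X.map Tok.val ++ [C.val⁻¹]).prod = 1 := by
    rw [List.prod_append, List.prod_singleton, mul_inv_eq_one]
    exact d.1.valL_eq
  obtain ⟨L, a, b, R, e, hab⟩ := exists_norm_mul_le
    (by have := List.length_pos_iff.2 d.1.ne_nil; simp; omega) hprod
  have normA : ∀ {A : DTy}, Short P m A → A.val.norm ≤ m := fun h => (DTy.norm_val_le _).trans h.2
  -- If nothing follows the pair, its second member is the inverse of the succedent; otherwise both
  -- members are items of `X`.
  rcases R.eq_nil_or_concat with rfl | ⟨R, b', rfl⟩
  · rw [show L ++ [a, b] = (L ++ [a]) ++ [b] by simp] at e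
    obtain ⟨e₁, e₂⟩ := List.append_inj' e rfl
    obtain rfl := List.singleton_injective e₂
    obtain ⟨L, Z, rfl, rfl, e₃⟩ := List.map_eq_append_iff.1 e₁
    obtain ⟨t, rfl, rfl⟩ := List.map_eq_singleton_iff.1 e₃
    clear e e₁ e₂ e₃ hprod
    cases t with
    | leaf A =>
      have sA := hs A (by simp)
      refine cutProv_of_last_leaf d hs hC ih (hab.trans ?_)
      rw [norm_inv_eq]
      exact max_le (normA sA) (normA hC)
    | op i =>
      obtain ⟨Y, R, e, -⟩ := Bal.exists_cl (R := []) d.1.bal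
      simp at e
    | cl i =>
      obtain ⟨L, Δ, rfl, b⟩ := Bal.exists_op (R := []) d.1.bal
      have e : L ++ .op i :: Δ ++ [Tok.cl i] = L ++ .op i :: (Δ ++ [.cl i]) := by simp
      rw [e] at d hs ih ⊢
      -- The hedge is fixed at this point because empty brackets are excluded only for strings that
      -- represent one.
      intro H hH
      by_cases h0 : Δ = []
      · subst h0
        exact (DP.not_empty_bracket (R := []) d.1 hH).elim
      exact cutProv_of_link_succedent d hs hC ih b h0
        (cnt_cl_ne_zero_of_norm_cl_mul_inv d.one_le_norm hab) H hH
  · rw [show L ++ a :: b :: R.concat b' = (L ++ a :: b :: R) ++ [b'] by simp] at e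
    obtain ⟨e₁, -⟩ := List.append_inj' e rfl
    obtain ⟨L, Z, rfl, rfl, e₂⟩ := List.map_eq_append_iff.1 e₁
    obtain ⟨s, Z, rfl, rfl, e₃⟩ := List.map_eq_cons_iff.1 e₂
    obtain ⟨t, R, rfl, rfl, rfl⟩ := List.map_eq_cons_iff.1 e₃
    clear e e₁ e₂ e₃ hprod
    have split : L ++ s :: t :: R = (L ++ [s]) ++ t :: R := by simp
    cases s with
    | leaf A =>
      have nA := d.one_le_norm_leaf
      cases t with
      | leaf B =>
        exact cutProv_of_adjacent_leaves d hs hC ih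
          (hab.trans (max_le (normA (hs A (by simp))) (normA (hs B (by simp)))))
      | op i =>
        obtain ⟨Δ, R, rfl, b⟩ := Bal.exists_cl (split ▸ d.1.bal)
        have e : L ++ .leaf A :: .op i :: (Δ ++ .cl i :: R) =
          L ++ (.leaf A :: .op i :: (Δ ++ [.cl i]) ++ R) := by simp
        intro H hH
        by_cases h0 : Δ = []
        · subst h0
          exact (DP.not_empty_bracket (split ▸ d.1) (split ▸ hH)).elim
        rw [e] at d hs ih hH
        exact cutProv_of_link_right d hs hC ih b h0 (cnt_op_ne_zero_of_norm_mul_op nA hab) H hH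
      | cl i =>
        obtain ⟨L', Δ, h1, b⟩ := Bal.exists_op (split ▸ d.1.bal)
        rcases Δ.eq_nil_or_concat with rfl | ⟨Δ, a, rfl⟩
        · simpa using (List.append_inj' h1 rfl).2
        rw [List.concat_eq_append, show L' ++ .op i :: (Δ ++ [a]) = (L' ++ .op i :: Δ) ++ [a] by
          simp] at h1
        obtain ⟨rfl, h2⟩ := List.append_inj' h1 rfl
        obtain rfl := List.singleton_injective h2
        have e : L' ++ .op i :: Δ ++ .leaf A :: .cl i :: R =
          L' ++ (.op i :: (Δ ++ .leaf A :: ([] ++ [.cl i])) ++ R) := by simp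
        rw [e] at d hs ih ⊢
        exact cutProv_of_link_inside d hs hC ih
          (Bal.left (Y := [.leaf A]) (by simp) (by simpa using b))
          (by simp) (cnt_cl_ne_zero_of_norm_mul_cl nA hab)
    | op i =>
      cases t with
      | leaf A =>
        have nA := ThinDP.one_le_norm_leaf (split ▸ d)
        obtain ⟨Δ, R', h1, b⟩ := d.1.bal.exists_cl
        rcases Δ with - | ⟨a, Δ⟩
        · cases (List.cons.inj h1).1
        obtain ⟨rfl, h1⟩ := List.cons.inj h1
        obtain rfl : R = Δ ++ .cl i :: R' := by assumption
        have e : L ++ .op i :: .leaf A :: (Δ ++ .cl i :: R') =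
          L ++ (.op i :: ([] ++ .leaf A :: (Δ ++ [.cl i])) ++ R') := by simp
        rw [e] at d hs ih ⊢
        exact cutProv_of_link_inside d hs hC ih (by simp) b (cnt_op_ne_zero_of_norm_op_mul nA hab)
      -- Two bracket generators, both with exponent 1, never cancel: their product has norm 2.
      | op j => exact absurd hab (not_norm_of_mul_of_le _ _)
      | cl j => exact absurd hab (not_norm_of_mul_of_le _ _)
    | cl i =>
      cases t with
      | leaf A =>
        have nA := ThinDP.one_le_norm_leaf (split ▸ d)
        obtain ⟨L, Δ, rfl, b⟩ := d.1.bal.exists_op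
        intro H hH
        by_cases h0 : Δ = []
        · subst h0
          have e' : L ++ [Tok.op i] ++ .cl i :: .leaf A :: R =
            L ++ .op i :: .cl i :: .leaf A :: R := by simp
          exact (DP.not_empty_bracket (e' ▸ d.1) (e' ▸ hH)).elim
        have e : L ++ .op i :: Δ ++ .cl i :: .leaf A :: R =
          L ++ (.op i :: (Δ ++ [.cl i, .leaf A]) ++ R) := by simp
        rw [e] at d hs ih hH
        exact cutProv_of_link_left d hs hC ih b h0 (cnt_cl_ne_zero_of_norm_cl_mul nA hab) H hH
      | op j => exact absurd hab (not_norm_of_mul_of_le _ _)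
      | cl j => exact absurd hab (not_norm_of_mul_of_le _ _)

end Main

mutual

theorem Tree.mem_yield {A : Ty} : (T : Tree) → .leaf A ∈ T.flat → A ∈ T.yield
  | .leaf B, h => by
    rw [Tree.yield]
    simpa using h
  | .node Γ, h => by
    rw [Tree.yield]
    exact mem_hedgeYield Γ (by simpa using h)

theorem mem_hedgeYield {A : Ty} : (Γ : List Tree) → .leaf A ∈ hedgeFlat Γ → A ∈ hedgeYield Γ
  | [], h => by simp at h
  | T :: Γ, h => by
    rw [hedgeYield, List.mem_append]
    rw [hedgeFlat_cons, List.mem_append] at h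
    exact h.imp T.mem_yield (mem_hedgeYield Γ)

end

end LDiamond

theorem mainTheorem6 (P : Set ℕ) (hP : P.Finite) (m : ℕ) :
    (LDiamond.cutBase P m).Finite ∧
    ∀ (Γ : LDiamond.Hedge) (C : LDiamond.Ty),
      (∀ A ∈ LDiamond.hedgeYield Γ, LDiamond.InTp P A ∧ A.length ≤ m) →
      LDiamond.InTp P C → C.length ≤ m →
      (LDiamond.Provable (Γ ⇒ C) ↔
        LDiamond.CutDerivable (LDiamond.cutBase P m) (Γ ⇒ C)) := by
  refine ⟨LDiamond.cutBase_finite hP m, fun Γ C hΓ hC hm => ⟨fun h => ?_, fun h => h.provable⟩⟩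
  -- Cut elimination is applied with liftability to a thin decorated sequent as the closed relation.
  obtain ⟨X, D, d, ht, e, rfl⟩ := LDiamond.Lift.rulesClosed.of_provable h
  refine LDiamond.ThinDP.cutProv ⟨d, ht⟩ (fun A hA => ?_) ⟨hC, ?_⟩ Γ e.symm
  · have := hΓ A.erase (LDiamond.mem_hedgeYield Γ (e ▸ List.mem_map_of_mem hA))
    rwa [LDiamond.DTy.length_erase] at this
  · rwa [LDiamond.DTy.length_erase] at hm
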